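/- Let $\Sigma=\{0,1\}^{\mathbb Z}$ with the metric $\mathrm{dist}(\omega,\tilde\omega)=2^{-k}$, $k=\min\{|i|:\omega^i\neq\tilde\omega^i\}$ (and distance $0$ if $\omega=\tilde\omega$), and let $\nu$ be the product measure on $\Sigma$ under which the $\omega^i$ are independent fair bits. Let $Q=\Sigma\times\mathbb R$ carry the maximum metric and the measure $\mu=\nu\times\mathrm{Leb}$. Fix real $\lambda_0,\lambda_1$ with $0<\lambda_0<1<\lambda_1$ and $\lambda_0\lambda_1\neq1$, let $\sigma$ be the left shift, $(\sigma\omega)^i=\omega^{i+1}$, and let $f:Q\to Q$, $f(\omega,x)=(\sigma\omega,\lambda_{\omega^0}x)$. For $q\in Q$, $d>0$ and $N\in\mathbb N$, let the random $d$-pseudotrajectory of length $N$ from $q$ be the Markov chain $q_0=q,q_1,\dots,q_N$ in which $q_{k+1}$ is uniformly distributed with respect to $\mu$ in the open ball of radius $d$ centred at $f(q_k)$. It is $\varepsilon$-shadowable if there are points $x_0,\dots,x_N\in Q$ with $x_{k+1}=f(x_k)$ for $0\le k<N$ and $\mathrm{dist}(x_k,q_k)<\varepsilon$ for $0\le k\le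 N$. Let $p(q,d,N,\varepsilon)$ be the probability of this event, and let $p(d,N,\varepsilon)=\int_\Sigma p((\omega,0),d,N,\varepsilon)\,d\nu(\omega)$. Put $a_i=\ln\lambda_i$. The equation $\frac12\left(e^{-ba_0}+e^{-ba_1}\right)=1$ has exactly one nonzero real root $b$, and $b>0$ if and only if $\lambda_0\lambda_1>1$. Let $c_0=1/|b|\in(0,\infty)$. Then there is $\varepsilon_0>0$ such that for every $\varepsilon\in(0,\varepsilon_0)$ and every real $c$: 1. if $c<c_0$, then $\lim_{N\to\infty}p(\varepsilon/N^c,N,\varepsilon)=0$; 2. if $c>c_0$, then $\lim_{N\to\infty}p(\varepsilon/N^c,N,\varepsilon)=1$. -/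

import Mathlib

open MeasureTheory ProbabilityTheory

namespace LinearSkewProduct

/-- The full two-sided shift space `{0, 1}^ℤ`. -/
abbrev Seq : Type := ℤ → Fin 2

/-- The phase space `Q = {0, 1}^ℤ × ℝ`. -/
abbrev Q : Type := Seq × ℝ

/-- The distance `2^{-k}` with `k = min {|i| : ω i ≠ ω' i}`, and `0` for equal sequences. -/
noncomputable def seqDist (ω ω' : Seq) : ℝ :=
  open Classical in
  if ω = ω' then 0 else (1 / 2) ^ sInf {k : ℕ | ∃ i : ℤ, i.natAbs = k ∧ ω i ≠ ω' i}

/-- The maximum metric on `Q`. -/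
noncomputable def qDist (p q : Q) : ℝ := max (seqDist p.1 q.1) |p.2 - q.2|

/-- The open ball of radius `d` centred at `q`. -/
def qBall (d : ℝ) (q : Q) : Set Q := {p | qDist p q < d}

/-- The standard probability measure on `{0, 1}^ℤ`: independent fair bits. -/
noncomputable def ν : Measure Seq :=
  Measure.infinitePi fun _ : ℤ => (PMF.uniformOfFintype (Fin 2)).toMeasure

instance : IsProbabilityMeasure ν := by
  unfold ν; infer_instance

/-- The measure `ν × Leb` on `Q`. -/
noncomputable def μ : Measure Q := ν.prod volume

instance : SFinite μ := by
  unfold μ; infer_instance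

/-- The left shift. -/
def shift (ω : Seq) : Seq := fun i => ω (i + 1)

/-- The linear skew product `f(ω, x) = (σ ω, λ_{ω⁰} x)`. -/
def skew (l₀ l₁ : ℝ) (q : Q) : Q :=
  (shift q.1, (if q.1 0 = 0 then l₀ else l₁) * q.2)

lemma seqDist_lt_iff (ω ω' : Seq) (d : ℝ) :
    seqDist ω ω' < d ↔ 0 < d ∧ ∀ i : ℤ, ω i ≠ ω' i → (1 / 2 : ℝ) ^ i.natAbs < d := by
  unfold seqDist
  split_ifs with h
  · subst h; simp
  · have hne : {k : ℕ | ∃ i : ℤ, i.natAbs = k ∧ ω i ≠ ω' i}.Nonempty := by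
      obtain ⟨i, hi⟩ := Function.ne_iff.mp h
      exact ⟨_, i, rfl, hi⟩
    constructor
    · intro hd
      refine ⟨lt_trans (by positivity) hd, fun i hi => lt_of_le_of_lt ?_ hd⟩
      exact pow_le_pow_of_le_one (by norm_num) (by norm_num) (Nat.sInf_le ⟨i, rfl, hi⟩)
    · rintro ⟨-, hd⟩
      obtain ⟨i, hi, hne'⟩ := Nat.sInf_mem hne
      rw [← hi]
      exact hd i hne'

lemma measurable_skew (l₀ l₁ : ℝ) : Measurable (skew l₀ l₁) := by
  unfold skew shift
  refine Measurable.prodMk (by fun_prop) (Measurable.mul ?_ measurable_snd)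
  refine Measurable.ite ?_ measurable_const measurable_const
  exact (show Measurable fun q : Q => q.1 0 by fun_prop) (measurableSet_singleton 0)

lemma measurableSet_qDist_lt (d : ℝ) : MeasurableSet {z : Q × Q | qDist z.2 z.1 < d} := by
  have h : {z : Q × Q | qDist z.2 z.1 < d} =
      ({z | 0 < d} ∩ ⋂ i : ℤ, ({z : Q × Q | z.2.1 i = z.1.1 i} ∪
        {z | (1 / 2 : ℝ) ^ i.natAbs < d})) ∩ {z | |z.2.2 - z.1.2| < d} := by
    ext z
    simp only [qDist, Set.mem_ofPred_eq, max_lt_iff, seqDist_lt_iff, Set.mem_inter_iff,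
      Set.mem_iInter, Set.mem_union, ne_eq, or_iff_not_imp_left]
  rw [h]
  refine MeasurableSet.inter (MeasurableSet.inter (MeasurableSet.const _)
    (MeasurableSet.iInter fun i => MeasurableSet.union ?_ (MeasurableSet.const _))) ?_
  · exact measurableSet_eq_fun (by fun_prop) (by fun_prop)
  · exact measurableSet_lt
      ((measurable_snd.snd.sub measurable_fst.snd).abs) measurable_const

/-- One step of the random pseudotrajectory: from `q`, the next point is uniformly distributed
(with respect to `μ`) in the open ball of radius `d` around the image of `q`. -/
noncomputable def step (l₀ l₁ d : ℝ) : Kernel Q Q where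
  toFun q := μ[|qBall d (skew l₀ l₁ q)]
  measurable' := by
    have hS : MeasurableSet {z : Q × Q | qDist z.2 (skew l₀ l₁ z.1) < d} :=
      (measurableSet_qDist_lt d).preimage
        (((measurable_skew l₀ l₁).comp measurable_fst).prodMk measurable_snd)
    have hB : ∀ q, MeasurableSet (qBall d (skew l₀ l₁ q)) := fun q =>
      hS.preimage measurable_prodMk_left
    refine Measure.measurable_of_measurable_coe _ fun s hs => ?_
    simp only [cond_apply (hB _)]
    refine Measurable.mul (Measurable.inv ?_) ?_
    · exact measurable_measure_prodMk_left hS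
    · exact measurable_measure_prodMk_left (hS.inter (hs.preimage measurable_snd))

instance (l₀ l₁ d : ℝ) : IsFiniteKernel (step l₀ l₁ d) :=
  ⟨1, by simp, fun q => by
    change (μ[|qBall d (skew l₀ l₁ q)]) Set.univ ≤ 1
    exact prob_le_one⟩

/-- The law of the random `d`-pseudotrajectory `q₀, …, q_N` (a Markov chain with transition
kernel `step`), as a function of its starting point `q₀`. -/
noncomputable def pathLaw (l₀ l₁ d : ℝ) : (N : ℕ) → Kernel Q (Fin (N + 1) → Q)
  | 0 => Kernel.deterministic (fun q _ => q) (by fun_prop)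
  | N + 1 =>
    (pathLaw l₀ l₁ d N ⊗ₖ
      (step l₀ l₁ d).comap (fun z : Q × (Fin (N + 1) → Q) => z.2 (Fin.last N))
        (by fun_prop)).map
      fun z : (Fin (N + 1) → Q) × Q => (Fin.snoc (α := fun _ => Q) z.1 z.2 : Fin (N + 2) → Q)

/-- The pseudotrajectory `y₀, …, y_N` is `ε`-shadowed by an exact trajectory. -/
def Shadowable (l₀ l₁ ε : ℝ) {N : ℕ} (y : Fin (N + 1) → Q) : Prop :=
  ∃ x : Fin (N + 1) → Q, (∀ k : Fin N, x k.succ = skew l₀ l₁ (x k.castSucc)) ∧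
    ∀ k, qDist (x k) (y k) < ε

/-- The probability that a random `d`-pseudotrajectory of length `N` started at `q` is
`ε`-shadowable. -/
noncomputable def shadowProbFrom (l₀ l₁ : ℝ) (q : Q) (d : ℝ) (N : ℕ) (ε : ℝ) : ENNReal :=
  pathLaw l₀ l₁ d N q {y | Shadowable l₀ l₁ ε y}

/-- `p(d, N, ε)`: the average over `ω` of the probability for the starting point `(ω, 0)`. -/
noncomputable def shadowProb (l₀ l₁ d : ℝ) (N : ℕ) (ε : ℝ) : ENNReal :=
  ∫⁻ ω, shadowProbFrom l₀ l₁ (ω, 0) d N ε ∂ν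

/-- The equation `(e^{-b a₀} + e^{-b a₁}) / 2 = 1` for `b`, where `a_i = ln λ_i`. -/
def IsRuinRoot (l₀ l₁ b : ℝ) : Prop :=
  (Real.exp (-b * Real.log l₀) + Real.exp (-b * Real.log l₁)) / 2 = 1

end LinearSkewProduct

/-! Let S_n be the sum of a over the first n bits of the pseudotrajectory. Two reductions come
first. When d ≤ ε the symbolic coordinate can always be shadowed: a step alters only coordinates too
far from 0 to be seen at scale ε, so the visible windows glue into one sequence
(`shadowable_of_real`). Moreover the bits and the normalized errors r_k of the real coordinate are
all independent, the bits fair and the errors uniform on (-1, 1) (`pathMeasure_incr`). What remains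
is the recursion e' = λe + dr driven by a random walk; a shadow must keep |e| < ε.

Case c > c₀. If b > 0 the walk drifts upward, and the trajectory with the same real end point is off
at time k by at most d · ∑_j exp(-(S_{k+j+1} - S_k)). If b < 0 the zero trajectory obeys the
mirror-image bound. Such sums exceed M with probability O(M^(-p)) for every p < |b|
(`measure_sum_exp_ge_le`). With M = N^c and 1/c < p, a union bound over the N + 1 times gives
O(N^(1-cp)), which tends to 0.

Case c < c₀. On a block of length T, shadowing forces d |∑ r_j exp(-S_{j+1})| < ε (1 + exp(-S_T)), S
being restarted at the block (`block_of_shadowable`). If the walk makes a valley of depth log(4M), M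
= N^c, the coefficient at the bottom is so large that the inequality fails with probability at least
1/2. One slope of the valley follows the drift and is cheap; the other is realized by tilting the
bits, so the valley costs about M^(-|b|), up to an arbitrarily small loss in the exponent
(`exists_valley`). It fits in O(log N) steps, so among N / log N independent blocks some block is
bad with probability tending to 1 (`shadowProb_le_pow`, `tendsto_exponent`). -/

namespace LinearSkewProduct

/-! ### The law of one step -/

/-- A fair bit. -/
noncomputable def fairBit : Measure (Fin 2) := (PMF.uniformOfFintype (Fin 2)).toMeasure

instance : IsProbabilityMeasure fairBit := by
  unfold fairBit; infer_instance

lemma fairBit_singleton (v : Fin 2) : fairBit {v} = 2⁻¹ := by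
  simp [fairBit]

/-- The uniform distribution on `(-1, 1)`. -/
noncomputable def noise : Measure ℝ := volume[|Set.Ioo (-1) 1]

instance : IsProbabilityMeasure noise := by
  unfold noise
  exact cond_isProbabilityMeasure_of_finite (by norm_num) (by norm_num)

lemma noise_apply (s : Set ℝ) : noise s = 2⁻¹ * volume (Set.Ioo (-1) 1 ∩ s) := by
  unfold noise
  rw [cond_apply measurableSet_Ioo, Real.volume_Ioo]
  norm_num

/-- The sequences that agree with `u` on `J`. -/
def cyl (J : Finset ℤ) (u : Seq) : Set Seq := {ω | ∀ i ∈ J, ω i = u i}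

lemma measurableSet_cyl (J : Finset ℤ) (u : Seq) : MeasurableSet (cyl J u) := by
  have : cyl J u = ⋂ i ∈ J, (fun ω : Seq => ω i) ⁻¹' {u i} := by
    ext; simp [cyl]
  rw [this]
  exact Finset.measurableSet_biInter _ fun i _ =>
    (measurable_pi_apply i) (measurableSet_singleton _)

lemma nu_cyl (J : Finset ℤ) (u : Seq) : ν (cyl J u) = 2⁻¹ ^ J.card := by
  have h : cyl J u = Set.pi (J : Set ℤ) fun i => {u i} := by
    ext; simp [cyl, Set.mem_pi]
  unfold ν
  rw [h, Measure.infinitePi_pi _ fun i _ => measurableSet_singleton _]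
  change ∏ i ∈ J, fairBit {u i} = _
  simp [fairBit_singleton]

lemma nu_cyl_inter (I J : Finset ℤ) (u w : Seq) [Decidable (∀ i ∈ J ∩ I, w i = u i)] :
    ν (cyl I w ∩ cyl J u) =
      2⁻¹ ^ I.card * if ∀ i ∈ J ∩ I, w i = u i then 2⁻¹ ^ (J \ I).card else 0 := by
  split_ifs with h
  · have : cyl I w ∩ cyl J u = cyl (I ∪ (J \ I)) (fun i => if i ∈ I then w i else u i) := by
      ext η
      simp only [cyl, Set.mem_inter_iff, Set.mem_ofPred_eq, Finset.mem_union, Finset.mem_sdiff]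
      simp only [Finset.mem_inter] at h
      constructor
      · rintro ⟨h1, h2⟩ i hi
        split_ifs with hI
        · exact h1 i hI
        · exact h2 i (by tauto)
      · intro h1
        refine ⟨fun i hi => by simpa [hi] using h1 i (Or.inl hi), fun i hi => ?_⟩
        have := h1 i (by tauto)
        split_ifs at this with hI
        · rw [this, h i ⟨hi, hI⟩]
        · exact this
    rw [this, nu_cyl, Finset.card_union_of_disjoint Finset.disjoint_sdiff, pow_add]
  · have : cyl I w ∩ cyl J u = ∅ := by
      ext η
      simp only [cyl, Set.mem_inter_iff, Set.mem_ofPred_eq, Set.mem_empty_iff_false, iff_false]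
      rintro ⟨h1, h2⟩
      refine h fun i hi => ?_
      rw [Finset.mem_inter] at hi
      rw [← h1 i hi.2, h2 i hi.1]
    simp [this]

/-- The coordinates that a perturbation of size less than `d` cannot change. -/
lemma exists_rigid (d : ℝ) (hd : 0 < d) :
    ∃ I : Finset ℤ, ∀ i, i ∈ I ↔ d ≤ (1 / 2 : ℝ) ^ i.natAbs := by
  have hf : {i : ℤ | d ≤ (1 / 2 : ℝ) ^ i.natAbs}.Finite := by
    obtain ⟨n, hn⟩ := exists_pow_lt_of_lt_one hd (show (1 / 2 : ℝ) < 1 by norm_num)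
    refine (Set.finite_Icc (-(n : ℤ)) n).subset fun i hi => ?_
    have hi' : d ≤ (1 / 2 : ℝ) ^ i.natAbs := hi
    have : i.natAbs < n := by
      by_contra hc
      have := pow_le_pow_of_le_one (by norm_num : (0 : ℝ) ≤ 1 / 2) (by norm_num) (not_lt.mp hc)
      linarith
    simp only [Set.mem_Icc]; omega
  exact ⟨hf.toFinset, by simp⟩

/-- The multiplier of a bit. -/
noncomputable def lam (l₀ l₁ : ℝ) (i : Fin 2) : ℝ := if i = 0 then l₀ else l₁

lemma skew_eq (l₀ l₁ : ℝ) (q : Q) : skew l₀ l₁ q = (shift q.1, lam l₀ l₁ (q.1 0) * q.2) := rfl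

lemma qBall_eq {d : ℝ} (hd : 0 < d) {I : Finset ℤ}
    (hI : ∀ i, i ∈ I ↔ d ≤ (1 / 2 : ℝ) ^ i.natAbs) (p : Q) :
    qBall d p = cyl I p.1 ×ˢ Set.Ioo (p.2 - d) (p.2 + d) := by
  ext z
  simp only [qBall, qDist, Set.mem_ofPred_eq, max_lt_iff, seqDist_lt_iff, Set.mem_prod, cyl,
    Set.mem_Ioo, abs_lt, hd, true_and]
  refine and_congr ⟨fun h i hi => ?_, fun h i hi => ?_⟩ ?_
  · by_contra hc
    exact absurd (h i hc) (not_lt.mpr ((hI i).mp hi))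
  · by_contra hc
    exact hi (h i ((hI i).mpr (not_lt.mp hc)))
  · constructor <;> rintro ⟨h1, h2⟩ <;> constructor <;> linarith

lemma volume_Ioo_inter {d : ℝ} (hd : 0 < d) (x : ℝ) (R : Set ℝ) :
    (volume (Set.Ioo (x - d) (x + d)))⁻¹ * volume (Set.Ioo (x - d) (x + d) ∩ R) =
      noise {r | x + d * r ∈ R} := by
  rw [noise_apply]
  have h1 : Set.Ioo (-1) 1 ∩ {r | x + d * r ∈ R} =
      (fun r => d * r) ⁻¹' ((fun r => x + r) ⁻¹' (Set.Ioo (x - d) (x + d) ∩ R)) := by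
    ext r
    simp only [Set.mem_inter_iff, Set.mem_Ioo, Set.mem_ofPred_eq, Set.mem_preimage]
    refine and_congr_left fun _ => ?_
    constructor
    · rintro ⟨h1, h2⟩; constructor <;> nlinarith
    · rintro ⟨h1, h2⟩; constructor <;> nlinarith
  rw [h1, Real.volume_preimage_mul_left hd.ne', measure_preimage_add, Real.volume_Ioo, ← mul_assoc]
  congr 1
  rw [abs_of_pos (by positivity), show x + d - (x - d) = 2 * d by ring, ENNReal.ofReal_mul (by norm_num),
    ENNReal.mul_inv (by simp) (by simp), ENNReal.ofReal_inv_of_pos hd]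
  simp

lemma mu_qBall {d : ℝ} (hd : 0 < d) (p : Q) : μ (qBall d p) ≠ 0 ∧ μ (qBall d p) ≠ ⊤ := by
  obtain ⟨I, hI⟩ := exists_rigid d hd
  rw [qBall_eq hd hI, μ, Measure.prod_prod, nu_cyl, Real.volume_Ioo]
  constructor
  · simp; linarith
  · finiteness

lemma isMarkovKernel_step (l₀ l₁ : ℝ) {d : ℝ} (hd : 0 < d) : IsMarkovKernel (step l₀ l₁ d) :=
  ⟨fun _ => cond_isProbabilityMeasure_of_finite (mu_qBall hd _).1 (mu_qBall hd _).2⟩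

lemma measurableSet_qBall (d : ℝ) (p : Q) : MeasurableSet (qBall d p) :=
  (measurableSet_qDist_lt d).preimage (measurable_prodMk_left (x := p))

/-- A ball is a cylinder over the rigid coordinates `I` times an interval. Hence a step copies the
coordinates in `I` from the shifted sequence, draws the others as fresh fair bits, and adds
independent uniform noise to the real coordinate. -/
lemma step_apply_prod (l₀ l₁ : ℝ) {d : ℝ} (hd : 0 < d) {I : Finset ℤ}
    (hI : ∀ i, i ∈ I ↔ d ≤ (1 / 2 : ℝ) ^ i.natAbs) (q : Q) (J : Finset ℤ) (u : Seq)
    (R : Set ℝ) [Decidable (∀ i ∈ J ∩ I, shift q.1 i = u i)] :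
    step l₀ l₁ d q (cyl J u ×ˢ R) =
      (if ∀ i ∈ J ∩ I, shift q.1 i = u i then 2⁻¹ ^ (J \ I).card else 0) *
        noise {r | lam l₀ l₁ (q.1 0) * q.2 + d * r ∈ R} := by
  change μ[|qBall d (skew l₀ l₁ q)] _ = _
  rw [cond_apply (measurableSet_qBall _ _), qBall_eq hd hI, Set.prod_inter_prod, μ,
    Measure.prod_prod, Measure.prod_prod, skew_eq, nu_cyl_inter, nu_cyl, ← volume_Ioo_inter hd,
    ENNReal.mul_inv (by simp) (by simp)]
  have h : ((2⁻¹ : ENNReal) ^ I.card)⁻¹ * 2⁻¹ ^ I.card = 1 :=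
    ENNReal.inv_mul_cancel (by simp) (by finiteness)
  rw [mul_mul_mul_comm, ← mul_assoc _ _ (ite _ _ _), h, one_mul]

/-! ### The path measure -/

/-- The law of the random pseudotrajectory started at `(ω, 0)` with `ω` distributed by `ν`. -/
noncomputable def pathMeasure (l₀ l₁ d : ℝ) (N : ℕ) : Measure (Fin (N + 1) → Q) :=
  ν.bind ((pathLaw l₀ l₁ d N).comap (fun ω : Seq => (ω, (0 : ℝ))) (by fun_prop))

lemma pathMeasure_apply (l₀ l₁ d : ℝ) (N : ℕ) {A : Set (Fin (N + 1) → Q)}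
    (hA : MeasurableSet A) :
    pathMeasure l₀ l₁ d N A = ∫⁻ ω, pathLaw l₀ l₁ d N (ω, 0) A ∂ν := by
  unfold pathMeasure
  rw [Measure.bind_apply hA (Kernel.aemeasurable _)]
  rfl

/-- This bound and `le_shadowProb` compare shadowability with measurable events, so its own
measurability is never needed. -/
lemma shadowProb_le (l₀ l₁ d : ℝ) (N : ℕ) (ε : ℝ) {A : Set (Fin (N + 1) → Q)}
    (hA : MeasurableSet A) (h : ∀ y, Shadowable l₀ l₁ ε y → y ∈ A) :
    shadowProb l₀ l₁ d N ε ≤ pathMeasure l₀ l₁ d N A := by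
  rw [pathMeasure_apply _ _ _ _ hA]
  exact lintegral_mono fun ω => measure_mono h

lemma le_shadowProb (l₀ l₁ d : ℝ) (N : ℕ) (ε : ℝ) {A : Set (Fin (N + 1) → Q)}
    (hA : MeasurableSet A) (h : ∀ y ∈ A, Shadowable l₀ l₁ ε y) :
    pathMeasure l₀ l₁ d N A ≤ shadowProb l₀ l₁ d N ε := by
  rw [pathMeasure_apply _ _ _ _ hA]
  exact lintegral_mono fun ω => measure_mono h

lemma measurable_snoc (N : ℕ) : Measurable fun z : (Fin (N + 1) → Q) × Q =>
    (Fin.snoc (α := fun _ => Q) z.1 z.2 : Fin (N + 2) → Q) := by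
  refine measurable_pi_lambda _ fun i => ?_
  refine Fin.lastCases ?_ (fun j => ?_) i
  · simpa using measurable_snd
  · simpa [Function.comp_def] using (measurable_pi_apply j).comp measurable_fst

lemma isMarkovKernel_pathLaw (l₀ l₁ : ℝ) {d : ℝ} (hd : 0 < d) (N : ℕ) :
    IsMarkovKernel (pathLaw l₀ l₁ d N) := by
  have := isMarkovKernel_step l₀ l₁ hd
  induction N with
  | zero => unfold pathLaw; infer_instance
  | succ N ih => unfold pathLaw; exact Kernel.IsMarkovKernel.map _ (measurable_snoc N)

lemma pathMeasure_succ_apply (l₀ l₁ : ℝ) {d : ℝ} (hd : 0 < d) (N : ℕ) {S : Set (Fin (N + 2) → Q)}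
    (hS : MeasurableSet S) :
    pathMeasure l₀ l₁ d (N + 1) S =
      ∫⁻ y, step l₀ l₁ d (y (Fin.last N)) {z | (Fin.snoc (α := fun _ => Q) y z) ∈ S}
        ∂pathMeasure l₀ l₁ d N := by
  have := isMarkovKernel_pathLaw l₀ l₁ hd N
  have hS' := measurable_snoc N hS
  have hm : Measurable fun y : Fin (N + 1) → Q =>
      step l₀ l₁ d (y (Fin.last N)) {z | (Fin.snoc (α := fun _ => Q) y z) ∈ S} :=
    Kernel.measurable_kernel_prodMk_left
      (κ := (step l₀ l₁ d).comap (fun y : Fin (N + 1) → Q => y (Fin.last N)) (by fun_prop)) hS'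
  rw [pathMeasure_apply _ _ _ _ hS, pathMeasure,
    Measure.lintegral_bind (Kernel.aemeasurable _) hm.aemeasurable]
  refine lintegral_congr fun ω => ?_
  rw [pathLaw, Kernel.map_apply' _ (measurable_snoc N) _ hS, Kernel.compProd_apply hS']
  rfl

lemma isProbabilityMeasure_pathMeasure (l₀ l₁ : ℝ) {d : ℝ} (hd : 0 < d) (N : ℕ) :
    IsProbabilityMeasure (pathMeasure l₀ l₁ d N) := by
  have := isMarkovKernel_pathLaw l₀ l₁ hd N
  constructor
  rw [pathMeasure_apply _ _ _ _ .univ]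
  simp

lemma shadowProb_le_one (l₀ l₁ : ℝ) {d : ℝ} (hd : 0 < d) (N : ℕ) (ε : ℝ) :
    shadowProb l₀ l₁ d N ε ≤ 1 := by
  have := isProbabilityMeasure_pathMeasure l₀ l₁ hd N
  exact (shadowProb_le l₀ l₁ d N ε .univ fun _ _ => trivial).trans prob_le_one

/-- The pseudotrajectories of step error `d` whose starting point has real coordinate `0`. -/
def admissible (l₀ l₁ d : ℝ) (N : ℕ) : Set (Fin (N + 1) → Q) :=
  {y | (y 0).2 = 0 ∧ ∀ k : Fin N, y k.succ ∈ qBall d (skew l₀ l₁ (y k.castSucc))}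

lemma measurableSet_admissible (l₀ l₁ d : ℝ) (N : ℕ) :
    MeasurableSet (admissible l₀ l₁ d N) := by
  have : admissible l₀ l₁ d N = (fun y : Fin (N + 1) → Q => (y 0).2) ⁻¹' {0} ∩
      ⋂ k : Fin N, (fun y : Fin (N + 1) → Q => (skew l₀ l₁ (y k.castSucc), y k.succ)) ⁻¹'
        {z : Q × Q | qDist z.2 z.1 < d} := by
    ext; simp [admissible, qBall]
  rw [this]
  refine MeasurableSet.inter (Measurable.snd (measurable_pi_apply 0) (measurableSet_singleton 0))
    (MeasurableSet.iInter fun k => ?_)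
  exact (((measurable_skew l₀ l₁).comp (measurable_pi_apply _)).prodMk (measurable_pi_apply _))
    (measurableSet_qDist_lt d)

lemma pathMeasure_admissible (l₀ l₁ : ℝ) {d : ℝ} (hd : 0 < d) (N : ℕ) :
    pathMeasure l₀ l₁ d N (admissible l₀ l₁ d N) = 1 := by
  induction N with
  | zero =>
    rw [pathMeasure_apply _ _ _ _ (measurableSet_admissible _ _ _ _)]
    simp only [pathLaw, Kernel.deterministic_apply]
    have : ∀ ω : Seq, Measure.dirac (fun _ : Fin (0 + 1) => ((ω, 0) : Q))
        (admissible l₀ l₁ d 0) = 1 := fun ω => by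
      rw [Measure.dirac_apply' _ (measurableSet_admissible _ _ _ _)]
      simp [admissible]
    simp [this]
  | succ N ih =>
    rw [pathMeasure_succ_apply _ _ hd _ (measurableSet_admissible _ _ _ _), ← ih,
      ← lintegral_indicator_one (measurableSet_admissible _ _ _ _)]
    refine lintegral_congr fun y => ?_
    have h : {z | (Fin.snoc (α := fun _ => Q) y z) ∈ admissible l₀ l₁ d (N + 1)} =
        {z | y ∈ admissible l₀ l₁ d N} ∩ qBall d (skew l₀ l₁ (y (Fin.last N))) := by
      ext z
      simp only [admissible, Set.mem_ofPred_eq, Set.mem_inter_iff, Fin.forall_fin_succ']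
      rw [← Fin.castSucc_zero]
      simp only [Fin.snoc_castSucc, Fin.succ_castSucc, Fin.succ_last, Fin.snoc_last]
      tauto
    rw [h]
    by_cases hy : y ∈ admissible l₀ l₁ d N
    · simp only [hy, Set.ofPred_true, Set.univ_inter, Set.indicator_of_mem, Pi.one_apply]
      change μ[|qBall d _] _ = 1
      exact cond_apply_self (mu_qBall hd _).1 (mu_qBall hd _).2
    · simp [hy]

/-! ### Independence of the bits and the errors -/

/-- The bits and the normalized errors of a pseudotrajectory. -/
noncomputable def incr (l₀ l₁ d : ℝ) {N : ℕ} (y : Fin (N + 1) → Q) : Fin N → Fin 2 × ℝ :=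
  fun k => ((y k.castSucc).1 0,
    ((y k.succ).2 - lam l₀ l₁ ((y k.castSucc).1 0) * (y k.castSucc).2) / d)

lemma measurable_lam (l₀ l₁ : ℝ) : Measurable (lam l₀ l₁) := measurable_of_finite _

lemma measurable_incr (l₀ l₁ d : ℝ) (N : ℕ) :
    Measurable (incr l₀ l₁ d : (Fin (N + 1) → Q) → Fin N → Fin 2 × ℝ) := by
  refine measurable_pi_lambda _ fun k => ?_
  have h0 : Measurable fun y : Fin (N + 1) → Q => (y k.castSucc).1 0 := by fun_prop
  refine h0.prodMk ?_
  have := (measurable_lam l₀ l₁).comp h0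
  simp only [Function.comp_def] at this
  fun_prop

/-- The law of the bit and the normalized error of a single step. -/
noncomputable def stepMeasure : Measure (Fin 2 × ℝ) := fairBit.prod noise

instance : IsProbabilityMeasure stepMeasure := by
  unfold stepMeasure; infer_instance

lemma stepMeasure_apply {s : Set (Fin 2 × ℝ)} (hs : MeasurableSet s) :
    stepMeasure s = ∑ v, 2⁻¹ * noise {r | (v, r) ∈ s} := by
  unfold stepMeasure
  rw [Measure.prod_apply hs, lintegral_fintype]
  refine Finset.sum_congr rfl fun v _ => ?_
  rw [fairBit_singleton, mul_comm]
  rfl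

lemma measurableSet_last (N : ℕ) (J : Finset ℤ) (u : Seq) :
    MeasurableSet {y : Fin (N + 1) → Q | (y (Fin.last N)).1 ∈ cyl J u} :=
  (Measurable.fst (measurable_pi_apply _)) (measurableSet_cyl J u)

/-- Independence is strengthened so that induction on `N` closes: the nonnegative coordinates of the
last point are still fair and independent of all increments so far. Negative coordinates must be
excluded, since they can remember bits already used. -/
theorem map_incr_restrict (l₀ l₁ : ℝ) {d : ℝ} (hd : 0 < d) (N : ℕ) :
    ∀ J : Finset ℤ, (∀ i ∈ J, 0 ≤ i) → ∀ u : Seq,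
      ((pathMeasure l₀ l₁ d N).restrict {y | (y (Fin.last N)).1 ∈ cyl J u}).map (incr l₀ l₁ d) =
        (2⁻¹ ^ J.card : ENNReal) • Measure.pi fun _ : Fin N => stepMeasure := by
  have hP := fun N => isProbabilityMeasure_pathMeasure l₀ l₁ hd N
  obtain ⟨I, hI⟩ := exists_rigid d hd
  induction N with
  | zero =>
    intro J _ u
    ext A hA
    rw [Measure.map_apply (measurable_incr _ _ _ _) hA,
      Measure.restrict_apply (measurable_incr _ _ _ _ hA), Measure.smul_apply, smul_eq_mul,
      ← nu_cyl J u]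
    rcases (Set.subsingleton_of_subsingleton (s := A)).eq_empty_or_singleton with h | h
    · simp [h]
    · obtain ⟨a, rfl⟩ := h
      have h1 : ({a} : Set (Fin 0 → Fin 2 × ℝ)) = Set.univ := Set.eq_univ_of_forall fun b =>
        Subsingleton.elim b a
      rw [h1, measure_univ, mul_one, Set.preimage_univ, Set.univ_inter,
        pathMeasure_apply _ _ _ _ (measurableSet_last _ _ _),
        ← lintegral_indicator_one (measurableSet_cyl J u)]
      refine lintegral_congr fun ω => ?_
      rw [pathLaw, Kernel.deterministic_apply, Measure.dirac_apply' _ (measurableSet_last _ _ _)]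
      rfl
  | succ N ih =>
    intro J hJ u
    have hmp := measurePreserving_piFinSuccAbove
      (fun _ : Fin (N + 1) => stepMeasure) (Fin.last N)
    set e := MeasurableEquiv.piFinSuccAbove (fun _ : Fin (N + 1) => Fin 2 × ℝ) (Fin.last N) with he
    rw [← e.map_measurableEquiv_injective.eq_iff, Measure.map_smul, hmp.map_eq]
    have := hP (N + 1)
    refine Measure.ext_prod fun {s B} hs hB => ?_
    have hms := measurable_incr l₀ l₁ d (N + 1) (e.measurable (hs.prod hB))
    rw [Measure.map_apply e.measurable (hs.prod hB),
      Measure.map_apply (measurable_incr _ _ _ _) (e.measurable (hs.prod hB)),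
      Measure.restrict_apply hms, Measure.smul_apply, Measure.prod_prod, smul_eq_mul,
      pathMeasure_succ_apply _ _ hd _ (hms.inter (measurableSet_last _ _ _)),
      stepMeasure_apply hs]
    -- What the new point requires of the previous one: coordinate 0 is the bit of the new
    -- increment, and each rigid coordinate `i ∈ J ∩ I` is copied from `i + 1`. As `i ≥ 0`, the two
    -- requirements never collide. The coordinates in `J \ I` are fresh.
    set J' : Finset ℤ := insert 0 ((J ∩ I).image (· + 1)) with hJ'
    set u' : Fin 2 → Seq := fun v i => if i = 0 then v else u (i - 1) with hu'
    have hJ'0 : ∀ i ∈ J', 0 ≤ i := by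
      intro i hi
      simp only [hJ', Finset.mem_insert, Finset.mem_image, Finset.mem_inter] at hi
      rcases hi with rfl | ⟨j, ⟨hj, _⟩, rfl⟩
      · rfl
      · have := hJ j hj; omega
    have hcard : J'.card = (J ∩ I).card + 1 := by
      rw [hJ', Finset.card_insert_of_notMem, Finset.card_image_of_injective _ (add_left_injective 1)]
      simp only [Finset.mem_image, Finset.mem_inter, not_exists, not_and, and_imp]
      intro j hj _ h
      have := hJ j hj; omega
    set g : Fin 2 → ENNReal := fun v => noise {r | (v, r) ∈ s} with hg
    set E : Fin 2 → Set (Fin (N + 1) → Q) := fun v =>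
      incr l₀ l₁ d ⁻¹' B ∩ {y | (y (Fin.last N)).1 ∈ cyl J' (u' v)} with hE
    have hEm : ∀ v, MeasurableSet (E v) := fun v =>
      (measurable_incr _ _ _ _ hB).inter (measurableSet_last _ _ _)
    have hint : ∀ y : Fin (N + 1) → Q, step l₀ l₁ d (y (Fin.last N))
        {z | (Fin.snoc (α := fun _ => Q) y z) ∈ incr l₀ l₁ d ⁻¹' (e ⁻¹' (s ×ˢ B)) ∩
          {y | (y (Fin.last (N + 1))).1 ∈ cyl J u}} =
        ∑ v, (E v).indicator (fun _ => 2⁻¹ ^ (J \ I).card * g v) y := by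
      intro y
      classical
      set q := y (Fin.last N) with hq
      have hset : {z | (Fin.snoc (α := fun _ => Q) y z) ∈ incr l₀ l₁ d ⁻¹' (e ⁻¹' (s ×ˢ B)) ∩
          {y | (y (Fin.last (N + 1))).1 ∈ cyl J u}} =
          {_z | y ∈ incr l₀ l₁ d ⁻¹' B} ∩
            cyl J u ×ˢ {t | (q.1 0, (t - lam l₀ l₁ (q.1 0) * q.2) / d) ∈ s} := by
        ext z
        have h1 : (e (incr l₀ l₁ d (Fin.snoc (α := fun _ => Q) y z))).1 =
            (q.1 0, (z.2 - lam l₀ l₁ (q.1 0) * q.2) / d) := by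
          simp [he, incr, hq]
        have h2 : (e (incr l₀ l₁ d (Fin.snoc (α := fun _ => Q) y z))).2 = incr l₀ l₁ d y := by
          funext k
          simp only [he, MeasurableEquiv.piFinSuccAbove_apply, Fin.insertNthEquiv_symm_apply,
            Fin.removeNth, Fin.succAbove_last, incr, Fin.succ_castSucc, Fin.snoc_castSucc]
        simp only [Set.mem_ofPred_eq, Set.mem_inter_iff, Set.mem_preimage, Set.mem_prod, h1, h2,
          Fin.snoc_last]
        tauto
      rw [hset]
      by_cases hB' : y ∈ incr l₀ l₁ d ⁻¹' B
      · simp only [hB', Set.ofPred_true, Set.univ_inter]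
        rw [step_apply_prod _ _ hd hI]
        have h3 : {r : ℝ | lam l₀ l₁ (q.1 0) * q.2 + d * r ∈
            {t | (q.1 0, (t - lam l₀ l₁ (q.1 0) * q.2) / d) ∈ s}} = {r | (q.1 0, r) ∈ s} := by
          ext r
          simp only [Set.mem_ofPred_eq, add_sub_cancel_left, mul_div_cancel_left₀ _ hd.ne']
        have h4 : ∀ v, y ∈ E v ↔ v = q.1 0 ∧ ∀ i ∈ J ∩ I, shift q.1 i = u i := by
          intro v
          simp only [hE, Set.mem_inter_iff, hB', true_and, Set.mem_ofPred_eq, cyl, hJ', hu',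
            Finset.forall_mem_insert, Finset.forall_mem_image, if_true, shift]
          refine and_congr eq_comm (forall₂_congr fun i hi => ?_)
          have := hJ i (Finset.mem_inter.mp hi).1
          rw [if_neg (by omega), add_sub_cancel_right]
        rw [h3, Finset.sum_eq_single (q.1 0)]
        · by_cases h5 : ∀ i ∈ J ∩ I, shift q.1 i = u i
          · rw [if_pos h5, Set.indicator_of_mem ((h4 _).mpr ⟨rfl, h5⟩)]
          · rw [if_neg h5, Set.indicator_of_notMem (fun h => h5 ((h4 _).mp h).2), zero_mul]
        · intro v _ hv
          exact Set.indicator_of_notMem (fun h => hv ((h4 _).mp h).1) _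
        · simp
      · have : ∀ v, y ∉ E v := fun v h => hB' h.1
        simp [hB', this]
    rw [lintegral_congr hint, lintegral_finsetSum _
      fun v _ => measurable_const.indicator (hEm v)]
    have hPE : ∀ v, pathMeasure l₀ l₁ d N (E v) =
        2⁻¹ ^ J'.card * (Measure.pi fun _ : Fin N => stepMeasure) B := by
      intro v
      rw [← smul_eq_mul, ← Measure.smul_apply, ← ih J' hJ'0 (u' v),
        Measure.map_apply (measurable_incr _ _ _ _) hB,
        Measure.restrict_apply (measurable_incr _ _ _ _ hB)]
    simp only [lintegral_indicator_const (hEm _), hPE, hcard]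
    have hJc : J.card = (J ∩ I).card + (J \ I).card := (Finset.card_inter_add_card_sdiff J I).symm
    rw [hJc, Finset.sum_mul, Finset.mul_sum]
    refine Finset.sum_congr rfl fun v _ => ?_
    rw [pow_succ, pow_add]
    simp only [hg]
    ring

/-- Under the law of the pseudotrajectory, the pairs of bits and normalized errors are
independent and identically distributed. -/
theorem pathMeasure_incr (l₀ l₁ : ℝ) {d : ℝ} (hd : 0 < d) (N : ℕ)
    {A : Set (Fin N → Fin 2 × ℝ)} (hA : MeasurableSet A) :
    pathMeasure l₀ l₁ d N (incr l₀ l₁ d ⁻¹' A) = (Measure.pi fun _ : Fin N => stepMeasure) A := by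
  have h := map_incr_restrict l₀ l₁ hd N ∅ (by simp) 0
  rw [show {y : Fin (N + 1) → Q | (y (Fin.last N)).1 ∈ cyl ∅ 0} = Set.univ by ext; simp [cyl],
    Measure.restrict_univ] at h
  rw [← Measure.map_apply (measurable_incr _ _ _ _) hA, h]
  simp

/-! ### Deterministic criteria for shadowing -/

/-- The sequence `i ↦ g (x i)`, extended by zero to all natural numbers. -/
noncomputable def walk {N : ℕ} (g : Fin 2 → ℝ) (x : Fin N → Fin 2) (i : ℕ) : ℝ :=
  if h : i < N then g (x ⟨i, h⟩) else 0

lemma walk_neg {N : ℕ} (g : Fin 2 → ℝ) (x : Fin N → Fin 2) (i : ℕ) :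
    walk (fun v => -g v) x i = -walk g x i := by
  unfold walk; split_ifs <;> simp

/-- The logarithm of the multiplier of a bit. -/
noncomputable def logLam (l₀ l₁ : ℝ) (v : Fin 2) : ℝ := Real.log (lam l₀ l₁ v)

lemma lam_pos {l₀ l₁ : ℝ} (h₀ : 0 < l₀) (h₁ : 0 < l₁) (v : Fin 2) : 0 < lam l₀ l₁ v := by
  unfold lam; split_ifs <;> assumption

lemma exp_logLam {l₀ l₁ : ℝ} (h₀ : 0 < l₀) (h₁ : 0 < l₁) (v : Fin 2) :
    Real.exp (logLam l₀ l₁ v) = lam l₀ l₁ v := Real.exp_log (lam_pos h₀ h₁ v)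

/-- The solution of an affine recursion. -/
lemma exp_neg_sum_mul (α r e : ℕ → ℝ) (d : ℝ) (T : ℕ)
    (h : ∀ j < T, e (j + 1) = Real.exp (α j) * e j + d * r j) :
    Real.exp (-∑ i ∈ Finset.range T, α i) * e T =
      e 0 + d * ∑ j ∈ Finset.range T, r j * Real.exp (-∑ i ∈ Finset.range (j + 1), α i) := by
  induction T with
  | zero => simp
  | succ T ih =>
    rw [Finset.sum_range_succ (fun j => r j * _), mul_add, ← add_assoc,
      ← ih fun j hj => h j (by omega), h T (by omega), Finset.sum_range_succ α,
      neg_add, Real.exp_add]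
    have : Real.exp (-α T) * Real.exp (α T) = 1 := by rw [← Real.exp_add]; simp
    linear_combination (Real.exp (-∑ i ∈ Finset.range T, α i) * e T) * this

lemma abs_sum_mul_le (s : Finset ℕ) (r c : ℕ → ℝ) (hr : ∀ j ∈ s, |r j| ≤ 1)
    (hc : ∀ j, 0 ≤ c j) : |∑ j ∈ s, r j * c j| ≤ ∑ j ∈ s, c j := by
  refine (Finset.abs_sum_le_sum_abs _ _).trans (Finset.sum_le_sum fun j hj => ?_)
  rw [abs_mul, abs_of_nonneg (hc j)]
  exact mul_le_of_le_one_left (hc j) (hr j hj)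

lemma abs_forward_le (α r t : ℕ → ℝ) {d : ℝ} (hd : 0 ≤ d) (N : ℕ) (h0 : t 0 = 0)
    (h : ∀ j < N, t (j + 1) = Real.exp (α j) * t j + d * r j) (hr : ∀ j < N, |r j| ≤ 1)
    (n : ℕ) (hn : n ≤ N) :
    |t n| ≤ d * ∑ j ∈ Finset.range n, Real.exp (∑ i ∈ Finset.Ico (j + 1) n, α i) := by
  have h1 := exp_neg_sum_mul α r t d n fun j hj => h j (by omega)
  rw [h0, zero_add] at h1
  have h2 : t n = d * ∑ j ∈ Finset.range n,
      r j * Real.exp (∑ i ∈ Finset.Ico (j + 1) n, α i) := by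
    have h3 : Real.exp (∑ i ∈ Finset.range n, α i) * Real.exp (-∑ i ∈ Finset.range n, α i) = 1 := by
      rw [← Real.exp_add]; simp
    have : t n = Real.exp (∑ i ∈ Finset.range n, α i) *
        (Real.exp (-∑ i ∈ Finset.range n, α i) * t n) := by
      rw [← mul_assoc, h3, one_mul]
    rw [this, h1, mul_left_comm, Finset.mul_sum]
    congr 1
    refine Finset.sum_congr rfl fun j hj => ?_
    rw [mul_left_comm, ← Real.exp_add, Finset.sum_Ico_eq_sub _ (Finset.mem_range.mp hj),
      sub_eq_add_neg]
  rw [h2, abs_mul, abs_of_nonneg hd]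
  refine mul_le_mul_of_nonneg_left (abs_sum_mul_le _ _ _ (fun j hj => hr j ?_) fun j => ?_) hd
  · have := Finset.mem_range.mp hj; omega
  · positivity

/-- The exact orbit through `t N` at time `N` is pulled back to time `k`; its deviation from `t k`
is the solution formula for the recursion restarted at `k`. -/
lemma abs_backward_le (α r t : ℕ → ℝ) {d : ℝ} (hd : 0 ≤ d) (N : ℕ)
    (h : ∀ j < N, t (j + 1) = Real.exp (α j) * t j + d * r j) (hr : ∀ j < N, |r j| ≤ 1)
    (k : ℕ) (hk : k ≤ N) :
    |Real.exp (-∑ i ∈ Finset.Ico k N, α i) * t N - t k| ≤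
      d * ∑ j ∈ Finset.range (N - k), Real.exp (-∑ i ∈ Finset.Ico k (k + j + 1), α i) := by
  have h1 := exp_neg_sum_mul (fun i => α (k + i)) (fun i => r (k + i)) (fun i => t (k + i)) d
    (N - k) fun j hj => h (k + j) (by omega)
  have hI : ∀ n, ∑ i ∈ Finset.Ico k (k + n), α i = ∑ i ∈ Finset.range n, α (k + i) := fun n => by
    rw [Finset.sum_Ico_eq_sum_range, Nat.add_sub_cancel_left]
  have hI' := hI (N - k)
  simp only [Nat.add_sub_cancel' hk, add_zero] at h1 hI'
  rw [hI', h1, add_sub_cancel_left, abs_mul, abs_of_nonneg hd]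
  simp only [add_assoc, hI]
  refine mul_le_mul_of_nonneg_left (abs_sum_mul_le _ _ _ (fun j hj => hr _ ?_) fun j => ?_) hd
  · have := Finset.mem_range.mp hj; omega
  · positivity

lemma half_pow_anti {m n : ℕ} (h : m ≤ n) : (1 / 2 : ℝ) ^ n ≤ (1 / 2) ^ m :=
  pow_le_pow_of_le_one (by norm_num) (by norm_num) h

/-- Pseudotrajectories with small steps are shadowed in the symbolic coordinate. -/
lemma shadowable_of_real {l₀ l₁ d ε : ℝ} (hd : 0 < d) (hε : d ≤ ε) {N : ℕ}
    {y : Fin (N + 1) → Q} (hy : y ∈ admissible l₀ l₁ d N) (s : ℕ → ℝ)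
    (hs : ∀ k : Fin N, s (k + 1) = lam l₀ l₁ ((y k.castSucc).1 0) * s k)
    (hst : ∀ k : Fin (N + 1), |s k - (y k).2| < ε) : Shadowable l₀ l₁ ε y := by
  set Y : ℕ → Seq := fun k => (y ⟨min k N, by omega⟩).1 with hY
  have hYk : ∀ k : Fin (N + 1), Y k = (y k).1 := fun k => by
    have : (⟨min (k : ℕ) N, by omega⟩ : Fin (N + 1)) = k := Fin.ext (by simp; omega)
    simp only [hY, this]
  have hstep : ∀ k < N, ∀ i : ℤ, ε ≤ (1 / 2 : ℝ) ^ i.natAbs → Y (k + 1) i = Y k (i + 1) := by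
    intro k hk i hi
    have h1 := hy.2 ⟨k, hk⟩
    simp only [qBall, qDist, Set.mem_ofPred_eq, max_lt_iff, seqDist_lt_iff] at h1
    have h2 := h1.1.2 i
    have e1 := hYk (Fin.succ ⟨k, hk⟩)
    have e2 := hYk (Fin.castSucc ⟨k, hk⟩)
    simp only [Fin.val_succ, Fin.val_castSucc] at e1 e2
    rw [e1, e2]
    by_contra hc
    linarith [h2 hc]
  -- A visible coordinate on the right moves toward 0 as time advances, so it stays visible and is
  -- copied at each step. On the left the same holds backwards in time.
  have hfw : ∀ k m : ℕ, k + m ≤ N → ∀ i : ℤ, (m : ℤ) ≤ i → ε ≤ (1 / 2 : ℝ) ^ i.natAbs →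
      Y k i = Y (k + m) (i - m) := by
    intro k m
    induction m with
    | zero => intros; simp
    | succ m ih =>
      intro hk i hi hε'
      rw [ih (by omega) i (by push_cast at hi; omega) hε', ← add_assoc, hstep _ (by omega)]
      · congr 1; push_cast; ring
      · push_cast at hi ⊢
        exact hε'.trans (half_pow_anti (by omega))
  have hbw : ∀ k m : ℕ, k + m ≤ N → ∀ i : ℤ, i + m ≤ 0 → ε ≤ (1 / 2 : ℝ) ^ i.natAbs →
      Y (k + m) i = Y k (i + m) := by
    intro k m
    induction m with
    | zero => intros; simp
    | succ m ih =>
      intro hk i hi hε'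
      rw [← add_assoc, hstep _ (by omega) _ hε', ih (by omega) (i + 1) (by push_cast at hi; omega)]
      · congr 1; push_cast; ring
      · push_cast at hi ⊢
        exact hε'.trans (half_pow_anti (by omega))
  -- The glued sequence: position `z` is read at coordinate 0 at time `z` if `0 ≤ z ≤ N`, from the
  -- initial sequence if `z < 0` (`toNat` gives time 0), and from the final one if `z > N`.
  set G : ℤ → Fin 2 := fun z => Y (min z N).toNat (z - (min z N).toNat) with hG
  have hGY : ∀ k ≤ N, ∀ i : ℤ, ε ≤ (1 / 2 : ℝ) ^ i.natAbs → G (k + i) = Y k i := by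
    intro k hk i hi
    rcases le_total 0 i with h0 | h0
    · obtain ⟨n, rfl⟩ := Int.eq_ofNat_of_zero_le h0
      have hm : (min ((k : ℤ) + n) N).toNat = k + min n (N - k) := by omega
      simp only [hG]
      rw [hfw k (min n (N - k)) (by omega) n (by omega) hi, hm]
      congr 1; push_cast; ring
    · obtain ⟨n, hn⟩ := Int.eq_ofNat_of_zero_le (neg_nonneg.mpr h0)
      have hm : (min ((k : ℤ) + i) N).toNat = k - min n k := by omega
      have h1 := hbw (k - min n k) (min n k) (by omega) i (by omega) hi
      rw [Nat.sub_add_cancel (min_le_right _ _)] at h1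
      simp only [hG]
      rw [h1, hm]
      congr 1; push_cast [Nat.cast_sub (min_le_right n k)]; ring
  refine ⟨fun k => (fun i => G (k + i), s k), fun k => ?_, fun k => ?_⟩
  · have h0 : G ((k : ℕ) : ℤ) = (y k.castSucc).1 0 := by
      have hm : (min ((k : ℕ) : ℤ) N).toNat = k := by omega
      simp only [hG, hm, sub_self]
      rw [← hYk, Fin.val_castSucc]
    ext1
    · funext i
      simp only [skew_eq, shift, Fin.val_succ, Fin.val_castSucc]
      congr 1; push_cast; ring
    · simp only [skew_eq, Fin.val_succ, Fin.val_castSucc, add_zero, h0, hs]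
  · simp only [qDist, max_lt_iff, seqDist_lt_iff]
    refine ⟨⟨hd.trans_le hε, fun i hi => ?_⟩, hst k⟩
    by_contra hc
    rw [not_lt] at hc
    exact hi ((hGY k (by omega) i hc).trans (by rw [hYk]))

lemma incr_recursion (l₀ l₁ : ℝ) {d : ℝ} (hd : 0 < d) {N : ℕ} (y : Fin (N + 1) → Q) (k : Fin N) :
    (y k.succ).2 = lam l₀ l₁ ((y k.castSucc).1 0) * (y k.castSucc).2 + d * (incr l₀ l₁ d y k).2 := by
  simp only [incr]
  field_simp
  ring

lemma abs_incr_le {l₀ l₁ d : ℝ} (hd : 0 < d) {N : ℕ} {y : Fin (N + 1) → Q}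
    (hy : y ∈ admissible l₀ l₁ d N) (k : Fin N) : |(incr l₀ l₁ d y k).2| ≤ 1 := by
  have h := hy.2 k
  simp only [qBall, qDist, Set.mem_ofPred_eq, max_lt_iff] at h
  simp only [incr]
  rw [abs_div, abs_of_pos hd, div_le_one hd]
  exact h.2.le

/-- The bits of a pseudotrajectory. -/
def bits {N : ℕ} (x : Fin N → Fin 2 × ℝ) : Fin N → Fin 2 := fun i => (x i).1

/-- The real coordinates of a pseudotrajectory, indexed by natural numbers, and its normalized
errors. -/
lemma exists_nat_sequences {l₀ l₁ d : ℝ} (h₀ : 0 < l₀) (h₁ : 0 < l₁) (hd : 0 < d) {N : ℕ}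
    (y : Fin (N + 1) → Q) :
    ∃ t r : ℕ → ℝ, (∀ k : Fin (N + 1), t k = (y k).2) ∧
      (∀ k : Fin N, r k = (incr l₀ l₁ d y k).2) ∧
      ∀ j < N, t (j + 1) =
        Real.exp (walk (logLam l₀ l₁) (bits (incr l₀ l₁ d y)) j) * t j + d * r j := by
  refine ⟨fun k => if h : k < N + 1 then (y ⟨k, h⟩).2 else 0,
    fun k => if h : k < N then (incr l₀ l₁ d y ⟨k, h⟩).2 else 0, fun k => dif_pos k.isLt,
    fun k => dif_pos k.isLt, fun j hj => ?_⟩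
  have h := incr_recursion l₀ l₁ hd y ⟨j, hj⟩
  simp only [hj, show j + 1 < N + 1 by omega, show j < N + 1 by omega, dif_pos, walk,
    exp_logLam h₀ h₁]
  exact h

lemma exp_walk_incr {l₀ l₁ d : ℝ} (h₀ : 0 < l₀) (h₁ : 0 < l₁) {N : ℕ}
    (y : Fin (N + 1) → Q) (k : Fin N) :
    Real.exp (walk (logLam l₀ l₁) (bits (incr l₀ l₁ d y)) k) =
      lam l₀ l₁ ((y k.castSucc).1 0) := by
  simp only [walk, k.isLt, dif_pos, exp_logLam h₀ h₁]
  rfl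

/-- The zero trajectory shadows when the errors do not accumulate forwards. -/
lemma shadowable_of_forward {l₀ l₁ d ε : ℝ} (h₀ : 0 < l₀) (h₁ : 0 < l₁) (hd : 0 < d)
    (hε : d ≤ ε) {N : ℕ} {y : Fin (N + 1) → Q} (hy : y ∈ admissible l₀ l₁ d N)
    (h : ∀ n ≤ N, d * ∑ j ∈ Finset.range n, Real.exp (∑ i ∈ Finset.Ico (j + 1) n,
      walk (logLam l₀ l₁) (bits (incr l₀ l₁ d y)) i) < ε) : Shadowable l₀ l₁ ε y := by
  obtain ⟨t, r, ht, hr, hrec⟩ := exists_nat_sequences h₀ h₁ hd y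
  refine shadowable_of_real hd hε hy (fun _ => 0) (by simp) fun k => ?_
  rw [zero_sub, abs_neg, ← ht]
  refine (abs_forward_le _ r t hd.le N ?_ hrec (fun j hj => ?_) k (by omega)).trans_lt
    (h k (by omega))
  · have := ht 0
    rw [hy.1] at this; exact this
  · have := hr ⟨j, hj⟩
    simp only at this
    rw [this]; exact abs_incr_le hd hy _

/-- The trajectory with the same end point shadows when the errors do not accumulate
backwards. -/
lemma shadowable_of_backward {l₀ l₁ d ε : ℝ} (h₀ : 0 < l₀) (h₁ : 0 < l₁) (hd : 0 < d)
    (hε : d ≤ ε) {N : ℕ} {y : Fin (N + 1) → Q} (hy : y ∈ admissible l₀ l₁ d N)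
    (h : ∀ k ≤ N, d * ∑ j ∈ Finset.range (N - k), Real.exp (∑ i ∈ Finset.Ico k (k + j + 1),
      walk (fun v => -logLam l₀ l₁ v) (bits (incr l₀ l₁ d y)) i) < ε) : Shadowable l₀ l₁ ε y := by
  obtain ⟨t, r, ht, hr, hrec⟩ := exists_nat_sequences h₀ h₁ hd y
  refine shadowable_of_real hd hε hy (fun k => Real.exp (-∑ i ∈ Finset.Ico k N,
    walk (logLam l₀ l₁) (bits (incr l₀ l₁ d y)) i) * t N) (fun k => ?_) fun k => ?_
  · rw [← exp_walk_incr (d := d) h₀ h₁ y k, ← mul_assoc, ← Real.exp_add,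
      Finset.sum_eq_sum_Ico_succ_bot k.isLt]
    congr 2; ring
  · rw [← ht]
    refine (abs_backward_le _ r t hd.le N hrec (fun j hj => ?_) k (by omega)).trans_lt ?_
    · have := hr ⟨j, hj⟩
      simp only at this
      rw [this]; exact abs_incr_le hd hy _
    · simpa only [walk_neg, Finset.sum_neg_distrib] using h k (by omega)

/-- On every block of a shadowable pseudotrajectory, the accumulated error is bounded. -/
lemma block_of_shadowable {l₀ l₁ d ε : ℝ} (h₀ : 0 < l₀) (h₁ : 0 < l₁) (hd : 0 < d)
    (hε : ε ≤ 1) {N : ℕ} {y : Fin (N + 1) → Q} (hy : Shadowable l₀ l₁ ε y) {T : ℕ}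
    (x : Fin T → Fin 2 × ℝ) (k : ℕ) (hk : k + T ≤ N)
    (hx : ∀ j : Fin T, x j = incr l₀ l₁ d y ⟨k + j, by omega⟩) :
    d * |∑ j : Fin T, (x j).2 * Real.exp (-∑ i ∈ Finset.range (j + 1),
      walk (logLam l₀ l₁) (bits x) i)| <
      ε * (1 + Real.exp (-∑ i ∈ Finset.range T, walk (logLam l₀ l₁) (bits x) i)) := by
  obtain ⟨z, hz, hzy⟩ := hy
  -- Since `ε ≤ 1`, a shadowing point has the same bit at 0, so both real coordinates are multiplied
  -- by the same factor and their difference obeys the affine recursion.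
  have hzy1 : ∀ k, (z k).1 0 = (y k).1 0 := fun k => by
    have := hzy k
    simp only [qDist, max_lt_iff, seqDist_lt_iff] at this
    by_contra hc
    have h1 := this.1.2 0 hc
    norm_num at h1
    linarith
  set E : ℕ → ℝ := fun j => if h : k + j < N + 1 then (y ⟨k + j, h⟩).2 - (z ⟨k + j, h⟩).2 else 0
    with hE
  set r : ℕ → ℝ := fun j => if h : j < T then (x ⟨j, h⟩).2 else 0 with hr
  have hEε : ∀ j ≤ T, |E j| < ε := fun j hj => by
    have h1 := hzy ⟨k + j, by omega⟩
    simp only [qDist, max_lt_iff] at h1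
    simp only [hE, show k + j < N + 1 by omega, dif_pos]
    rw [abs_sub_comm]; exact h1.2
  have hrec : ∀ j < T, E (j + 1) =
      Real.exp (walk (logLam l₀ l₁) (bits x) j) * E j + d * r j := fun j hj => by
    have h1 := incr_recursion l₀ l₁ hd y ⟨k + j, by omega⟩
    have h2 := congrArg Prod.snd (hz ⟨k + j, by omega⟩)
    have h3 := hx ⟨j, hj⟩
    have h4 := hzy1 (Fin.castSucc ⟨k + j, by omega⟩)
    rw [← h3] at h1
    rw [skew_eq, h4] at h2
    simp only [hE, hr, show k + (j + 1) < N + 1 by omega, show k + j < N + 1 by omega, hj, dif_pos,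
      walk, exp_logLam h₀ h₁]
    have h5 : bits x ⟨j, hj⟩ = (y (Fin.castSucc ⟨k + j, by omega⟩)).1 0 := by
      simp only [bits, h3]; rfl
    rw [h5]
    simp only [Fin.succ_mk, Fin.castSucc_mk] at h1 h2 ⊢
    simp only [add_assoc] at h1 h2
    rw [h1, h2]
    ring
  have h := exp_neg_sum_mul _ r E d T hrec
  have hsum : ∑ j ∈ Finset.range T, r j * Real.exp (-∑ i ∈ Finset.range (j + 1),
      walk (logLam l₀ l₁) (bits x) i) = ∑ j : Fin T, (x j).2 *
        Real.exp (-∑ i ∈ Finset.range (j + 1), walk (logLam l₀ l₁) (bits x) i) := by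
    rw [Finset.sum_range]
    simp [hr]
  rw [← hsum]
  set S := Real.exp (-∑ i ∈ Finset.range T, walk (logLam l₀ l₁) (bits x) i) with hS
  have hSpos : 0 < S := Real.exp_pos _
  rw [show d * |∑ j ∈ Finset.range T, r j * Real.exp (-∑ i ∈ Finset.range (j + 1),
      walk (logLam l₀ l₁) (bits x) i)| = |S * E T - E 0| by
    rw [h, add_sub_cancel_left, abs_mul, abs_of_pos hd]]
  calc |S * E T - E 0| ≤ |S * E T| + |E 0| := abs_sub _ _
    _ = S * |E T| + |E 0| := by rw [abs_mul, abs_of_pos hSpos]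
    _ < S * ε + ε := add_lt_add (mul_lt_mul_of_pos_left (hEε T le_rfl) hSpos) (hEε 0 (by omega))
    _ = _ := by ring

/-! ### Exponential moments and tails of perpetuities -/

/-- The law of `N` independent fair bits. -/
noncomputable abbrev bitMeasure (N : ℕ) : Measure (Fin N → Fin 2) := Measure.pi fun _ => fairBit

/-- The law of the bits and normalized errors of a pseudotrajectory of length `N`. -/
noncomputable abbrev incrMeasure (N : ℕ) : Measure (Fin N → Fin 2 × ℝ) :=
  Measure.pi fun _ => stepMeasure

lemma measurePreserving_bits (N : ℕ) :
    MeasurePreserving (bits : (Fin N → Fin 2 × ℝ) → _) (incrMeasure N) (bitMeasure N) :=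
  measurePreserving_pi (fun _ : Fin N => stepMeasure) (fun _ => fairBit)
    fun _ => measurePreserving_fst

/-- The exponential moment of a function of a fair bit. -/
noncomputable def expMean (g : Fin 2 → ℝ) : ℝ := (Real.exp (g 0) + Real.exp (g 1)) / 2

lemma expMean_pos (g : Fin 2 → ℝ) : 0 < expMean g := by unfold expMean; positivity

lemma integral_fairBit (f : Fin 2 → ℝ) : ∫ v, f v ∂fairBit = (f 0 + f 1) / 2 := by
  rw [integral_fintype .of_finite]
  simp [Measure.real, fairBit_singleton]
  ring

lemma sum_walk {N : ℕ} (g : Fin 2 → ℝ) (w : Fin N → Fin 2) {s : Finset ℕ}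
    (hs : s ⊆ Finset.range N) :
    ∑ i ∈ s, walk g w i = ∑ i : Fin N, if (i : ℕ) ∈ s then g (w i) else 0 := by
  have h1 : ∑ i ∈ s, walk g w i = ∑ i ∈ Finset.range N, if i ∈ s then walk g w i else 0 := by
    rw [Finset.sum_ite_mem, Finset.inter_eq_right.mpr hs]
  rw [h1, Finset.sum_range]
  refine Finset.sum_congr rfl fun i _ => ?_
  simp [walk]

lemma integral_exp_sum_walk {N : ℕ} (g : Fin 2 → ℝ) {s : Finset ℕ} (hs : s ⊆ Finset.range N) :
    ∫ w, Real.exp (∑ i ∈ s, walk g w i) ∂bitMeasure N = expMean g ^ s.card := by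
  simp only [sum_walk g _ hs, Real.exp_sum]
  rw [integral_fintype_prod_eq_prod
    (f := fun i : Fin N => fun v => Real.exp (if (i : ℕ) ∈ s then g v else 0))]
  have : ∀ i : Fin N, ∫ v, Real.exp (if (i : ℕ) ∈ s then g v else 0) ∂fairBit =
      if (i : ℕ) ∈ s then expMean g else 1 := fun i => by
    rw [integral_fairBit]
    split_ifs <;> simp [expMean]
  simp only [this]
  rw [← Finset.prod_range (fun i => if i ∈ s then expMean g else 1), Finset.prod_ite_mem,
    Finset.inter_eq_right.mpr hs, Finset.prod_const]

lemma measure_le_sum_walk_le {N : ℕ} (g : Fin 2 → ℝ) {s : Finset ℕ} (hs : s ⊆ Finset.range N)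
    (κ : ℝ) : (bitMeasure N).real {w | κ ≤ ∑ i ∈ s, walk g w i} ≤
      expMean g ^ s.card * Real.exp (-κ) := by
  have h := mul_meas_ge_le_integral_of_nonneg (μ := bitMeasure N)
    (f := fun w => Real.exp (∑ i ∈ s, walk g w i)) (.of_forall fun _ => (Real.exp_pos _).le)
    .of_finite (Real.exp κ)
  rw [integral_exp_sum_walk g hs] at h
  simp only [Real.exp_le_exp] at h
  rw [Real.exp_neg, ← div_eq_mul_inv, le_div_iff₀ (Real.exp_pos _), mul_comm]
  exact h

lemma sum_pow_le {R : Finset ℕ} {h : ℕ → ℕ} (hinj : Set.InjOn h R) {q : ℝ} (h0 : 0 ≤ q)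
    (h1 : q < 1) : ∑ j ∈ R, q ^ h j ≤ (1 - q)⁻¹ := by
  rw [← Finset.sum_image hinj, ← tsum_geometric_of_lt_one h0 h1]
  exact (summable_geometric_of_lt_one h0 h1).sum_le_tsum _ fun _ _ => by positivity

/-- The tail of a perpetuity: a sum of exponentials of the walk over sets of growing size. -/
lemma measure_sum_exp_ge_le (g : Fin 2 → ℝ) {p : ℝ} (hp : 0 < p)
    (hg : expMean (fun v => p * g v) < 1) : ∃ C : ℝ, 0 < C ∧ ∀ (N : ℕ) (R : Finset ℕ)
      (S : ℕ → Finset ℕ) (h : ℕ → ℕ), Set.InjOn h R → (∀ j ∈ R, S j ⊆ Finset.range N) →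
      (∀ j ∈ R, h j ≤ (S j).card) → ∀ M : ℝ, 0 < M →
      (bitMeasure N).real {w | M ≤ ∑ j ∈ R, Real.exp (∑ i ∈ S j, walk g w i)} ≤ C * M ^ (-p) := by
  set ρ := expMean fun v => p * g v with hρ
  have hρ0 : 0 < ρ := expMean_pos _
  -- The level `M` is split among the terms in shares `(1 - η) M η ^ h j`. With `η ^ p = θ` and `ρ <
  -- θ < 1`, the shares sum to at most `M`, while the Chernoff bounds for the terms decay like `(ρ /
  -- θ) ^ h j`. This treats `p < 1` and `p ≥ 1` alike.
  obtain ⟨θ, hθ1, hθ2⟩ := exists_between hg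
  have hθ0 : 0 < θ := hρ0.trans hθ1
  set η := θ ^ (1 / p) with hη
  have hη0 : 0 < η := by positivity
  have hη1 : η < 1 := Real.rpow_lt_one hθ0.le hθ2 (by positivity)
  have hηp : η ^ p = θ := by
    rw [hη, ← Real.rpow_mul hθ0.le, one_div_mul_cancel hp.ne', Real.rpow_one]
  have hq1 : ρ / θ < 1 := (div_lt_one hθ0).mpr hθ1
  refine ⟨(1 - η) ^ (-p) * (1 - ρ / θ)⁻¹, mul_pos (Real.rpow_pos_of_pos (by linarith) _)
    (inv_pos.mpr (by linarith)), fun N R S h hinj hS hh M hM => ?_⟩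
  set L : ℕ → ℝ := fun n => Real.log ((1 - η) * M * η ^ n) with hL
  have hpos : ∀ n : ℕ, 0 < (1 - η) * M * η ^ n := fun n =>
    mul_pos (mul_pos (by linarith) hM) (by positivity)
  have hsub : {w : Fin N → Fin 2 | M ≤ ∑ j ∈ R, Real.exp (∑ i ∈ S j, walk g w i)} ⊆
      ⋃ j ∈ R, {w | p * L (h j) ≤ ∑ i ∈ S j, walk (fun v => p * g v) w i} := by
    intro w hw
    by_contra hc
    simp only [Set.mem_iUnion, Set.mem_ofPred_eq, not_exists, not_le] at hc
    have hlt : ∀ j ∈ R, Real.exp (∑ i ∈ S j, walk g w i) < (1 - η) * M * η ^ h j := by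
      intro j hj
      have h1 := hc j hj
      have h2 : ∑ i ∈ S j, walk (fun v => p * g v) w i = p * ∑ i ∈ S j, walk g w i := by
        rw [Finset.mul_sum]
        refine Finset.sum_congr rfl fun i _ => ?_
        unfold walk; split_ifs <;> simp
      rw [h2, mul_lt_mul_iff_right₀ hp, hL, Real.lt_log_iff_exp_lt (hpos _)] at h1
      exact h1
    have hne : R.Nonempty := by
      rw [Finset.nonempty_iff_ne_empty]
      rintro rfl
      have : M ≤ 0 := by simpa using hw
      linarith
    have h3 := Finset.sum_lt_sum_of_nonempty hne hlt
    rw [← Finset.mul_sum] at h3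
    have h4 := mul_le_mul_of_nonneg_left (sum_pow_le hinj hη0.le hη1)
      (mul_pos (sub_pos.mpr hη1) hM).le
    have h5 : (1 - η) * M * (1 - η)⁻¹ = M := by
      field_simp [(sub_pos.mpr hη1).ne']
    have h6 : M ≤ ∑ j ∈ R, Real.exp (∑ i ∈ S j, walk g w i) := hw
    linarith
  calc _ ≤ (bitMeasure N).real
        (⋃ j ∈ R, {w | p * L (h j) ≤ ∑ i ∈ S j, walk (fun v => p * g v) w i}) :=
        measureReal_mono hsub (measure_ne_top _ _)
    _ ≤ ∑ j ∈ R, (bitMeasure N).real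
        {w | p * L (h j) ≤ ∑ i ∈ S j, walk (fun v => p * g v) w i} :=
        measureReal_biUnion_finset_le _ _
    _ ≤ ∑ j ∈ R, (1 - η) ^ (-p) * M ^ (-p) * (ρ / θ) ^ h j := by
        refine Finset.sum_le_sum fun j hj => (measure_le_sum_walk_le _ (hS j hj) _).trans ?_
        have h1 : Real.exp (-(p * L (h j))) = (1 - η) ^ (-p) * M ^ (-p) * (θ ^ h j)⁻¹ := by
          rw [← neg_mul, mul_comm, hL, ← Real.rpow_def_of_pos (hpos _),
            Real.mul_rpow (mul_pos (sub_pos.mpr hη1) hM).le (by positivity),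
            Real.mul_rpow (sub_pos.mpr hη1).le hM.le, ← Real.rpow_natCast η, ← Real.rpow_mul hη0.le,
            mul_comm _ (-p), Real.rpow_mul hη0.le, Real.rpow_neg hη0.le, hηp, Real.rpow_natCast,
            inv_pow]
        rw [h1, div_pow, div_eq_mul_inv]
        have h2 : ρ ^ (S j).card ≤ ρ ^ h j := pow_le_pow_of_le_one hρ0.le hg.le (hh j hj)
        have h3 : 0 ≤ (1 - η) ^ (-p) * M ^ (-p) * (θ ^ h j)⁻¹ :=
          mul_nonneg (mul_nonneg (Real.rpow_nonneg (sub_pos.mpr hη1).le _)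
            (Real.rpow_nonneg hM.le _)) (by positivity)
        calc _ ≤ ρ ^ h j * ((1 - η) ^ (-p) * M ^ (-p) * (θ ^ h j)⁻¹) :=
              mul_le_mul_of_nonneg_right h2 h3
          _ = _ := by ring
    _ ≤ (1 - η) ^ (-p) * M ^ (-p) * (1 - ρ / θ)⁻¹ := by
        rw [← Finset.mul_sum]
        exact mul_le_mul_of_nonneg_left (sum_pow_le hinj (by positivity) hq1)
          (mul_nonneg (Real.rpow_nonneg (sub_pos.mpr hη1).le _) (Real.rpow_nonneg hM.le _))
    _ = _ := by ring

/-! ### The root b and the tilted law -/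

/-- A weighted exponential mean drops below `1` in the direction of a negative drift. -/
lemma exists_exp_mean_lt_one (α h : Fin 2 → ℝ) (hα : ∀ v, 0 ≤ α v) (h1 : α 0 + α 1 = 1)
    (hh : α 0 * h 0 + α 1 * h 1 < 0) :
    ∃ θ₀ : ℝ, 0 < θ₀ ∧ ∀ θ, 0 < θ → θ ≤ θ₀ →
      α 0 * Real.exp (θ * h 0) + α 1 * Real.exp (θ * h 1) < 1 := by
  set m := -(α 0 * h 0 + α 1 * h 1) with hm
  set B := |h 0| + |h 1| + 1 with hB
  have hB1 : 1 ≤ B := by linarith [abs_nonneg (h 0), abs_nonneg (h 1)]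
  have hB0 : 0 < B := by linarith
  have hm0 : 0 < m := by rw [hm]; linarith
  have hmB : m / (2 * B ^ 2) > 0 := by positivity
  -- The first bound makes `|θ * h v| ≤ 1`, as the quadratic estimate of exp needs; the second keeps
  -- the quadratic term below half of the linear gain `θ * m`.
  refine ⟨min (1 / B) (m / (2 * B ^ 2)), by positivity, fun θ hθ hθ' => ?_⟩
  have hθ1 : θ * B ≤ 1 := (le_div_iff₀ hB0).mp (hθ'.trans (min_le_left _ _))
  have hθ2 : θ * (2 * B ^ 2) ≤ m := (le_div_iff₀ (by positivity)).mp (hθ'.trans (min_le_right _ _))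
  have hb : ∀ v, |h v| ≤ B := by
    intro v
    fin_cases v <;> simp [hB] <;> linarith [abs_nonneg (h 0), abs_nonneg (h 1)]
  have key : ∀ v, Real.exp (θ * h v) ≤ 1 + θ * h v + θ ^ 2 * B ^ 2 := by
    intro v
    have h2 : |θ * h v| ≤ 1 := by
      rw [abs_mul, abs_of_pos hθ]
      exact (mul_le_mul_of_nonneg_left (hb v) hθ.le).trans hθ1
    have h3 := (abs_le.mp (Real.abs_exp_sub_one_sub_id_le h2)).2
    have h4 : (θ * h v) ^ 2 ≤ θ ^ 2 * B ^ 2 := by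
      rw [mul_pow]
      exact mul_le_mul_of_nonneg_left (sq_le_sq' (abs_le.mp (hb v)).1 (abs_le.mp (hb v)).2)
        (by positivity)
    linarith
  have k0 := mul_le_mul_of_nonneg_left (key 0) (hα 0)
  have k1 := mul_le_mul_of_nonneg_left (key 1) (hα 1)
  have e : α 0 * (1 + θ * h 0 + θ ^ 2 * B ^ 2) + α 1 * (1 + θ * h 1 + θ ^ 2 * B ^ 2) =
      1 - θ * m + θ ^ 2 * B ^ 2 := by
    rw [hm]
    linear_combination (1 + θ ^ 2 * B ^ 2) * h1
  have : θ ^ 2 * B ^ 2 < θ * m := by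
    nlinarith [mul_pos hθ hm0]
  linarith

/-- Intermediate value theorem: the moment is below 1 just to the right of 0, where its slope is
minus the mean, and above 1 at `-2 / a v`, where the single term exp 2 suffices. -/
lemma exists_expMean_eq_one_of_mean_pos (a : Fin 2 → ℝ) (v : Fin 2) (hv : a v < 0)
    (hs : 0 < a 0 + a 1) : ∃ b : ℝ, 0 < b ∧ expMean (fun v => -b * a v) = 1 := by
  obtain ⟨θ₀, hθ₀, hθ⟩ := exists_exp_mean_lt_one (fun _ => 1 / 2) (fun v => -a v)
    (fun _ => by norm_num) (by norm_num) (by linarith)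
  set B := -2 / a v with hB
  have hB0 : 0 < B := div_pos_of_neg_of_neg (by norm_num) hv
  set θ := min θ₀ B with hθdef
  have hθ0 : 0 < θ := lt_min hθ₀ hB0
  have h1 : expMean (fun v => -θ * a v) < 1 := by
    have := hθ θ hθ0 (min_le_left _ _)
    simp only [mul_neg] at this
    simp only [expMean, neg_mul]
    linarith
  have h2 : 1 ≤ expMean (fun v => -B * a v) := by
    have h3 : -B * a v = 2 := by
      have := hv.ne
      rw [hB]; field_simp
    have h4 := Real.add_one_le_exp (-B * a v)
    rw [h3] at h4
    have h5 : Real.exp (-B * a v) ≤ 2 * expMean (fun v => -B * a v) := by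
      simp only [expMean]
      have e0 := Real.exp_pos (-B * a 0)
      have e1 := Real.exp_pos (-B * a 1)
      fin_cases v <;> simp only [Fin.zero_eta, Fin.mk_one] <;> linarith
    rw [h3] at h5
    linarith
  have hcont : ContinuousOn (fun b : ℝ => expMean (fun v => -b * a v)) (Set.Icc θ B) := by
    unfold expMean; fun_prop
  obtain ⟨b, hb, hb1⟩ := intermediate_value_Icc (min_le_right θ₀ B) hcont ⟨h1.le, h2⟩
  exact ⟨b, hθ0.trans_le hb.1, hb1⟩

/-- From x + 1 ≤ exp x, strict at `g 0`. For g = -b a it says that b has the sign of the drift. -/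
lemma sum_neg_of_expMean_eq_one {g : Fin 2 → ℝ} (h0 : g 0 ≠ 0) (hg : expMean g = 1) :
    g 0 + g 1 < 0 := by
  unfold expMean at hg
  linarith [Real.add_one_lt_exp h0, Real.add_one_le_exp (g 1)]

/-- From x exp x ≥ exp x - 1, strict at `g 0`. Tilting by the root thus reverses the drift. -/
lemma tilted_mean_pos_of_expMean_eq_one {g : Fin 2 → ℝ} (h0 : g 0 ≠ 0) (hg : expMean g = 1) :
    0 < Real.exp (g 0) / 2 * g 0 + Real.exp (g 1) / 2 * g 1 := by
  unfold expMean at hg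
  have key : ∀ x : ℝ, Real.exp x * (-x + 1) ≤ 1 := fun x => by
    have := mul_le_mul_of_nonneg_left (Real.add_one_le_exp (-x)) (Real.exp_pos x).le
    rwa [← Real.exp_add, add_neg_cancel, Real.exp_zero] at this
  have key' : Real.exp (g 0) * (-g 0 + 1) < 1 := by
    have := mul_lt_mul_of_pos_left (Real.add_one_lt_exp (neg_ne_zero.mpr h0)) (Real.exp_pos (g 0))
    rwa [← Real.exp_add, add_neg_cancel, Real.exp_zero] at this
  linarith [key (g 1)]

/-- Strict convexity between s = 0 and s = 1, where the value is 1. It yields both the uniqueness of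
b and the tail exponents p < |b|. -/
lemma expMean_smul_lt_one {g : Fin 2 → ℝ} (h0 : g 0 ≠ 0) (hg : expMean g = 1) {s : ℝ}
    (hs0 : 0 < s) (hs1 : s < 1) : expMean (fun v => s * g v) < 1 := by
  have k0 := strictConvexOn_exp.2 (Set.mem_univ (g 0)) (Set.mem_univ 0) h0 hs0 (sub_pos.mpr hs1)
    (by ring)
  have k1 := convexOn_exp.2 (Set.mem_univ (g 1)) (Set.mem_univ 0) hs0.le (sub_pos.mpr hs1).le
    (by ring)
  simp only [smul_eq_mul, mul_zero, add_zero, Real.exp_zero, mul_one] at k0 k1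
  unfold expMean at hg ⊢
  nlinarith

lemma isRuinRoot_iff (l₀ l₁ b : ℝ) :
    IsRuinRoot l₀ l₁ b ↔ expMean (fun v => -b * logLam l₀ l₁ v) = 1 := Iff.rfl

/-- The nonzero root `b` exists, is unique and has the sign of the mean. -/
lemma exists_unique_root (a : Fin 2 → ℝ) (h0 : a 0 < 0) (h1 : 0 < a 1) (hs : a 0 + a 1 ≠ 0) :
    ∃ b : ℝ, b ≠ 0 ∧ expMean (fun v => -b * a v) = 1 ∧
      (∀ b' : ℝ, b' ≠ 0 → expMean (fun v => -b' * a v) = 1 → b' = b) ∧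
      0 < b * (a 0 + a 1) := by
  have hsign : ∀ b : ℝ, b ≠ 0 → expMean (fun v => -b * a v) = 1 → 0 < b * (a 0 + a 1) := by
    intro b hb h
    have := sum_neg_of_expMean_eq_one (mul_ne_zero (neg_ne_zero.mpr hb) h0.ne) h
    linarith
  have hlt : ∀ b b' : ℝ, expMean (fun v => -b * a v) = 1 → expMean (fun v => -b' * a v) = 1 →
      0 < b' / b → ¬ b' / b < 1 := by
    intro b b' h h' hpos hlt
    have hb : b ≠ 0 := by rintro rfl; simp at hpos
    have := expMean_smul_lt_one (mul_ne_zero (neg_ne_zero.mpr hb) h0.ne) h hpos hlt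
    have e : ∀ v, b' / b * (-b * a v) = -b' * a v := fun v => by field_simp
    simp only [e, h'] at this
    exact lt_irrefl _ this
  have huniq : ∀ b b' : ℝ, b ≠ 0 → b' ≠ 0 → expMean (fun v => -b * a v) = 1 →
      expMean (fun v => -b' * a v) = 1 → b' = b := by
    intro b b' hb hb' h h'
    have hbb : 0 < b' / b := by
      have h2 := mul_pos (hsign b hb h) (hsign b' hb' h')
      have h3 : 0 < b' * b := by
        have : 0 < (b' * b) * (a 0 + a 1) ^ 2 := by linarith
        exact pos_of_mul_pos_left this (sq_nonneg _)
      have : b' / b = b' * b / b ^ 2 := by field_simp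
      rw [this]; positivity
    have h4 := hlt b b' h h' hbb
    have h5 := hlt b' b h' h (by rw [← inv_div]; positivity)
    rw [← inv_div, inv_lt_one₀ hbb] at h5
    exact (div_eq_one_iff_eq hb).mp (le_antisymm (not_lt.mp h5) (not_lt.mp h4))
  rcases hs.lt_or_gt with hs | hs
  · obtain ⟨b, hb, hb1⟩ := exists_expMean_eq_one_of_mean_pos (fun v => -a v) 1 (by simpa)
      (by linarith)
    have hb1' : expMean (fun v => -(-b) * a v) = 1 := by simpa using hb1
    exact ⟨-b, by simpa using hb.ne', hb1', fun b' hb' h => huniq _ _ (by simpa using hb.ne') hb' hb1' h,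
      hsign _ (by simpa using hb.ne') hb1'⟩
  · obtain ⟨b, hb, hb1⟩ := exists_expMean_eq_one_of_mean_pos a 0 h0 hs
    exact ⟨b, hb.ne', hb1, fun b' hb' h => huniq _ _ hb.ne' hb' hb1 h, hsign _ hb.ne' hb1⟩

/-- The mean of `a` under the law of a bit tilted by `e^g`. -/
noncomputable def tiltedMean (g a : Fin 2 → ℝ) : ℝ :=
  Real.exp (g 0) / 2 * a 0 + Real.exp (g 1) / 2 * a 1

/-- As `expMean g = 1`, the weights e^g / 2 form a probability law, and the bounded quantity is its
exponential moment of θ(a - x), a variable of negative mean. -/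
lemma exists_tilted_tail (g a : Fin 2 → ℝ) (hg : expMean g = 1) {x : ℝ}
    (hx : tiltedMean g a < x) :
    ∃ θ : ℝ, 0 < θ ∧ expMean (fun v => g v + θ * (a v - x)) < 1 := by
  unfold expMean at hg
  unfold tiltedMean at hx
  obtain ⟨θ, hθ, h⟩ := exists_exp_mean_lt_one (fun v => Real.exp (g v) / 2) (fun v => a v - x)
    (fun _ => by positivity) (by linarith) (by
      simp only [mul_sub]
      have : Real.exp (g 0) / 2 * x + Real.exp (g 1) / 2 * x = x := by
        linear_combination x * hg
      linarith)
  refine ⟨θ, hθ, ?_⟩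
  have := h θ hθ le_rfl
  simp only [expMean, Real.exp_add]
  linarith

lemma sum_walk_add_mul {n : ℕ} (g a : Fin 2 → ℝ) (θ x : ℝ) (w : Fin n → Fin 2) :
    ∑ i ∈ Finset.range n, walk (fun v => g v + θ * (a v - x)) w i =
      ∑ i ∈ Finset.range n, walk g w i + θ * (∑ i ∈ Finset.range n, walk a w i - n * x) := by
  simp only [sum_walk _ _ subset_rfl, Finset.mem_range, Fin.is_lt, if_true]
  simp only [Finset.sum_add_distrib, ← Finset.mul_sum, Finset.sum_sub_distrib]
  simp

/-! ### Lower bounds for descents and valleys -/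

/-- Lower large deviation bound, by tilting. -/
lemma exists_le_measure_near_tiltedMean (a : Fin 2 → ℝ) (b : ℝ)
    (hb : expMean (fun v => -b * a v) = 1) {δ : ℝ} (hδ : 0 < δ) :
    ∃ n₀ : ℕ, ∀ n ≥ n₀,
      1 / 2 * Real.exp (n * (b * tiltedMean (fun v => -b * a v) a - |b| * δ)) ≤
      (bitMeasure n).real {w | |∑ i ∈ Finset.range n, walk a w i -
        n * tiltedMean (fun v => -b * a v) a| ≤ n * δ} := by
  set g : Fin 2 → ℝ := fun v => -b * a v with hgdef
  set m := tiltedMean g a with hm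
  obtain ⟨θ₁, hθ₁, h1⟩ := exists_tilted_tail g a hb (x := m + δ) (by linarith)
  obtain ⟨θ₂, hθ₂, h2⟩ := exists_tilted_tail g (fun v => -a v) hb (x := -m + δ) (by
    have : tiltedMean g (fun v => -a v) = -m := by rw [hm]; unfold tiltedMean; ring
    linarith)
  set κ₁ := expMean (fun v => g v + θ₁ * (a v - (m + δ))) with hκ₁
  set κ₂ := expMean (fun v => g v + θ₂ * (-a v - (-m + δ))) with hκ₂
  have ht : Filter.Tendsto (fun n : ℕ => κ₁ ^ n + κ₂ ^ n) Filter.atTop (nhds (0 + 0)) :=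
    (tendsto_pow_atTop_nhds_zero_of_lt_one (expMean_pos _).le h1).add
      (tendsto_pow_atTop_nhds_zero_of_lt_one (expMean_pos _).le h2)
  rw [add_zero] at ht
  obtain ⟨n₀, hn₀⟩ := Filter.eventually_atTop.mp
    (ht.eventually (eventually_le_nhds (show (0 : ℝ) < 1 / 2 by norm_num)))
  refine ⟨n₀, fun n hn => ?_⟩
  set A : Set (Fin n → Fin 2) :=
    {w | |∑ i ∈ Finset.range n, walk a w i - n * m| ≤ n * δ} with hA
  set K : ℝ := n * (|b| * δ - b * m) with hK
  have hgw : ∀ w : Fin n → Fin 2,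
      ∑ i ∈ Finset.range n, walk g w i = -b * ∑ i ∈ Finset.range n, walk a w i := fun w => by
    simp only [sum_walk _ _ subset_rfl, Finset.mem_range, Fin.is_lt, if_true, hgdef,
      Finset.mul_sum]
  -- The tilting density is at most e^K on `A`, and off `A` it is dominated by one of two Chernoff
  -- terms. Integrating gives 1 ≤ P(A) e^K + κ₁^n + κ₂^n.
  have hpt : ∀ w : Fin n → Fin 2, Real.exp (∑ i ∈ Finset.range n, walk g w i) ≤
      A.indicator (fun _ => Real.exp K) w +
      (Real.exp (∑ i ∈ Finset.range n, walk (fun v => g v + θ₁ * (a v - (m + δ))) w i) +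
       Real.exp (∑ i ∈ Finset.range n, walk (fun v => g v + θ₂ * (-a v - (-m + δ))) w i)) := by
    intro w
    rw [sum_walk_add_mul, sum_walk_add_mul g (fun v => -a v)]
    simp only [walk_neg, Finset.sum_neg_distrib]
    by_cases hw : w ∈ A
    · rw [Set.indicator_of_mem hw]
      have : ∑ i ∈ Finset.range n, walk g w i ≤ K := by
        have h3 : |b * (∑ i ∈ Finset.range n, walk a w i - n * m)| ≤ |b| * (n * δ) := by
          rw [abs_mul]; exact mul_le_mul_of_nonneg_left hw (abs_nonneg b)
        rw [hgw, hK]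
        linarith [(abs_le.mp h3).1]
      have h4 := Real.exp_le_exp.mpr this
      have := Real.exp_pos
      exact h4.trans (le_add_of_nonneg_right (by positivity))
    · rw [Set.indicator_of_notMem hw, zero_add]
      have hw' : (n : ℝ) * δ < |∑ i ∈ Finset.range n, walk a w i - n * m| := not_le.mp hw
      rcases lt_abs.mp hw' with h | h
      · refine le_trans (Real.exp_le_exp.mpr ?_) (le_add_of_nonneg_right (Real.exp_pos _).le)
        exact le_add_of_nonneg_right (mul_nonneg hθ₁.le (by linarith))
      · refine le_trans (Real.exp_le_exp.mpr ?_) (le_add_of_nonneg_left (Real.exp_pos _).le)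
        exact le_add_of_nonneg_right (mul_nonneg hθ₂.le (by linarith))
  have hint := integral_mono (μ := bitMeasure n) .of_finite .of_finite hpt
  rw [integral_add .of_finite .of_finite, integral_add .of_finite .of_finite,
    integral_exp_sum_walk _ subset_rfl, integral_exp_sum_walk _ subset_rfl,
    integral_exp_sum_walk _ subset_rfl, hb, one_pow, Finset.card_range, ← hκ₁, ← hκ₂,
    integral_indicator_const _ (Set.toFinite A).measurableSet, smul_eq_mul] at hint
  have h5 : 1 / 2 ≤ (bitMeasure n).real A * Real.exp K := by linarith [hn₀ n hn]
  have h6 : Real.exp (n * (b * m - |b| * δ)) = Real.exp (-K) := by rw [hK]; congr 1; ring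
  rw [h6, Real.exp_neg, ← div_eq_mul_inv, div_le_iff₀ (Real.exp_pos _)]
  exact h5

/-- The cost of a descent of depth `ℓ`. -/
lemma exists_descent (a : Fin 2 → ℝ) (b : ℝ) (hb : expMean (fun v => -b * a v) = 1)
    (hb0 : 0 ≤ b) (hm : tiltedMean (fun v => -b * a v) a < 0) {β : ℝ} (hβ : b < β) :
    ∃ C K : ℝ, 0 < C ∧ 0 < K ∧ ∀ ℓ : ℝ, 1 ≤ ℓ → ∃ n : ℕ, 1 ≤ n ∧ (n : ℝ) ≤ K * ℓ ∧
      C * Real.exp (-(β * ℓ)) ≤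
        (bitMeasure n).real {w | ∑ i ∈ Finset.range n, walk a w i ≤ -ℓ} := by
  set m := -tiltedMean (fun v => -b * a v) a with hmdef
  have hm0 : 0 < m := by rw [hmdef]; linarith
  -- Small enough that b (m + δ) ≤ β (m - δ): the cost per step over the least depth gained per step
  -- is then at most β.
  set δ := m * (β - b) / (2 * (β + b)) with hδ
  have hβ0 : 0 < β := hb0.trans_lt hβ
  have hδ0 : 0 < δ := div_pos (mul_pos hm0 (by linarith)) (by linarith)
  have hδ1 : δ * (2 * (β + b)) = m * (β - b) := div_mul_cancel₀ _ (by linarith)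
  have hδ2 : δ ≤ m / 2 := by
    rw [hδ, div_le_div_iff₀ (by linarith) (by norm_num)]
    nlinarith
  obtain ⟨n₀, hn₀⟩ := exists_le_measure_near_tiltedMean a b hb hδ0
  have hmδ : 0 < m - δ := by linarith
  refine ⟨1 / 2 * Real.exp (-(b * (m + δ) * (n₀ + 1))), 1 / (m - δ) + n₀ + 1, by positivity,
    by positivity, fun ℓ hℓ => ?_⟩
  set n := n₀ + ⌈ℓ / (m - δ)⌉₊ with hn
  have hℓ0 : 0 < ℓ / (m - δ) := div_pos (by linarith) hmδ
  have hn1 : ℓ / (m - δ) ≤ n := by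
    rw [hn]; push_cast
    linarith [Nat.le_ceil (ℓ / (m - δ)), (Nat.cast_nonneg n₀ : (0 : ℝ) ≤ n₀)]
  have hn2 : (n : ℝ) ≤ n₀ + 1 + ℓ / (m - δ) := by
    rw [hn]; push_cast
    linarith [Nat.ceil_lt_add_one hℓ0.le]
  refine ⟨n, ?_, ?_, ?_⟩
  · have := Nat.ceil_pos.mpr hℓ0
    omega
  · calc (n : ℝ) ≤ (n₀ + 1) * 1 + ℓ / (m - δ) := by linarith
      _ ≤ (n₀ + 1) * ℓ + ℓ / (m - δ) := by gcongr
      _ = _ := by ring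
  · refine le_trans ?_ ((hn₀ n (by omega)).trans (measureReal_mono ?_ (measure_ne_top _ _)))
    · rw [mul_assoc, ← Real.exp_add, abs_of_nonneg hb0]
      refine mul_le_mul_of_nonneg_left (Real.exp_le_exp.mpr ?_) (by norm_num)
      have h1 : b * (m + δ) ≤ β * (m - δ) := by nlinarith
      have h2 : b * (m + δ) * (n : ℝ) ≤ b * (m + δ) * (n₀ + 1 + ℓ / (m - δ)) :=
        mul_le_mul_of_nonneg_left hn2 (by positivity)
      have h3 : b * (m + δ) * (ℓ / (m - δ)) ≤ β * (m - δ) * (ℓ / (m - δ)) :=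
        mul_le_mul_of_nonneg_right h1 hℓ0.le
      have h4 : β * (m - δ) * (ℓ / (m - δ)) = β * ℓ := by field_simp
      have h5 : (n : ℝ) * (b * tiltedMean (fun v => -b * a v) a - b * δ) =
          -(b * (m + δ) * n) := by rw [hmdef]; ring
      rw [h5]
      linarith
    · intro w hw
      rw [Set.mem_ofPred_eq] at hw
      have h1 := (abs_le.mp hw).2
      have h2 : ℓ ≤ n * (m - δ) := (div_le_iff₀ hmδ).mp hn1
      change _ ≤ -ℓ
      rw [show tiltedMean (fun v => -b * a v) a = -m by rw [hmdef, neg_neg]] at h1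
      linarith

lemma tiltedMean_zero (a : Fin 2 → ℝ) : tiltedMean (fun v => -0 * a v) a = (a 0 + a 1) / 2 := by
  simp [tiltedMean]; ring

/-- The cost of a valley of depth `ℓ`: a descent followed by an ascent. -/
lemma exists_valley (a : Fin 2 → ℝ) (h0 : a 0 < 0) {b : ℝ} (hb0 : b ≠ 0)
    (hb : expMean (fun v => -b * a v) = 1) {β : ℝ} (hβ : |b| < β) :
    ∃ C K : ℝ, 0 < C ∧ 0 < K ∧ ∀ ℓ : ℝ, 1 ≤ ℓ → ∃ n₁ n₂ : ℕ, 1 ≤ n₁ ∧ (n₁ + n₂ : ℝ) ≤ K * ℓ ∧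
      C * Real.exp (-(β * ℓ)) ≤
        (bitMeasure n₁).real {w | ∑ i ∈ Finset.range n₁, walk a w i ≤ -ℓ} *
        (bitMeasure n₂).real {w | ℓ ≤ ∑ i ∈ Finset.range n₂, walk a w i} := by
  have hs := sum_neg_of_expMean_eq_one (mul_ne_zero (neg_ne_zero.mpr hb0) h0.ne) hb
  have ht := tilted_mean_pos_of_expMean_eq_one (mul_ne_zero (neg_ne_zero.mpr hb0) h0.ne) hb
  have hs' : 0 < b * (a 0 + a 1) := by linarith
  have ht' : b * tiltedMean (fun v => -b * a v) a < 0 := by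
    unfold tiltedMean
    linarith
  -- The rates of the two slopes: the one along the drift has rate 0, i.e. no tilt, and the one
  -- against it has rate |b|.
  obtain ⟨b₁, b₂, hb₁, hb₂, hbb, he₁, he₂, hm₁, hm₂⟩ : ∃ b₁ b₂ : ℝ, 0 ≤ b₁ ∧ 0 ≤ b₂ ∧
      b₁ + b₂ = |b| ∧ expMean (fun v => -b₁ * a v) = 1 ∧ expMean (fun v => -b₂ * -a v) = 1 ∧
      tiltedMean (fun v => -b₁ * a v) a < 0 ∧
      tiltedMean (fun v => -b₂ * -a v) (fun v => -a v) < 0 := by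
    rcases hb0.lt_or_gt with hneg | hpos
    · refine ⟨0, -b, le_rfl, by linarith, by rw [zero_add, abs_of_neg hneg], by simp [expMean],
        by simpa using hb, ?_, ?_⟩
      · rw [tiltedMean_zero]; nlinarith
      · have : tiltedMean (fun v => -(-b) * -a v) (fun v => -a v) =
            -tiltedMean (fun v => -b * a v) a := by
          simp only [tiltedMean, neg_neg, mul_neg, neg_mul]; ring
        rw [this]; nlinarith
    · refine ⟨b, 0, hpos.le, le_rfl, by rw [add_zero, abs_of_pos hpos], hb, by simp [expMean], ?_, ?_⟩
      · nlinarith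
      · rw [tiltedMean_zero]; nlinarith
  obtain ⟨C₁, K₁, hC₁, hK₁, h₁⟩ := exists_descent a b₁ he₁ hb₁ hm₁
    (β := b₁ + (β - |b|) / 2) (by linarith)
  obtain ⟨C₂, K₂, hC₂, hK₂, h₂⟩ := exists_descent (fun v => -a v) b₂ he₂ hb₂ hm₂
    (β := b₂ + (β - |b|) / 2) (by linarith)
  refine ⟨C₁ * C₂, K₁ + K₂, by positivity, by positivity, fun ℓ hℓ => ?_⟩
  obtain ⟨n₁, hn₁, hnK₁, hp₁⟩ := h₁ ℓ hℓ
  obtain ⟨n₂, -, hnK₂, hp₂⟩ := h₂ ℓ hℓ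
  refine ⟨n₁, n₂, hn₁, by linarith, ?_⟩
  simp only [walk_neg, Finset.sum_neg_distrib, neg_le_neg_iff] at hp₂
  refine le_trans (le_of_eq ?_) (mul_le_mul hp₁ hp₂ (by positivity) measureReal_nonneg)
  rw [mul_mul_mul_comm, ← Real.exp_add]
  congr 2
  linear_combination ℓ * hbb

/-! ### Independent blocks -/

lemma measurePreserving_append {X : Type*} [MeasurableSpace X] (m : Measure X)
    [IsProbabilityMeasure m] (p q : ℕ) :
    MeasurePreserving (fun z : (Fin p → X) × (Fin q → X) => Fin.append z.1 z.2)
      ((Measure.pi fun _ => m).prod (Measure.pi fun _ => m)) (Measure.pi fun _ => m) := by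
  have hm : Measurable (fun z : (Fin p → X) × (Fin q → X) => Fin.append z.1 z.2) := by
    refine measurable_pi_lambda _ fun i => ?_
    refine Fin.addCases (fun j => ?_) (fun j => ?_) i
    · simpa [Function.comp_def] using (measurable_pi_apply j).comp measurable_fst
    · simpa [Function.comp_def] using (measurable_pi_apply j).comp measurable_snd
  refine ⟨hm, (Measure.pi_eq fun s hs => ?_).symm⟩
  rw [Measure.map_apply hm (MeasurableSet.univ_pi hs), Fin.prod_univ_add, ← Measure.pi_pi,
    ← Measure.pi_pi, ← Measure.prod_prod]
  congr 1
  ext z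
  simp only [Set.mem_preimage, Set.mem_pi, Set.mem_univ, true_imp_iff, Set.mem_prod]
  rw [Fin.forall_fin_add]
  simp

lemma block_index_lt {T n N i : ℕ} (h : T * n ≤ N) (hi : i < n) (j : Fin T) : T * i + j < N := by
  have := Nat.mul_le_mul_left T (Nat.succ_le_of_lt hi)
  rw [Nat.mul_succ] at this
  omega

/-- Consecutive blocks of an independent sequence are independent. -/
lemma measure_blocks {X : Type*} [MeasurableSpace X] (m : Measure X) [IsProbabilityMeasure m]
    {T : ℕ} {G : Set (Fin T → X)} (hG : MeasurableSet G) (n : ℕ) :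
    ∀ (N : ℕ) (h : T * n ≤ N), (Measure.pi fun _ : Fin N => m)
      {x | ∀ (i : ℕ) (hi : i < n), (fun j : Fin T => x ⟨T * i + j, block_index_lt h hi j⟩) ∈ G} =
        (Measure.pi fun _ : Fin T => m) G ^ n := by
  induction n with
  | zero => intro N h; simp
  | succ n ih =>
    intro N h
    obtain ⟨N', rfl⟩ : ∃ N', N = T + N' := ⟨N - T, by rw [Nat.mul_succ] at h; omega⟩
    have h' : T * n ≤ N' := by rw [Nat.mul_succ] at h; omega
    have hS : MeasurableSet {x : Fin (T + N') → X | ∀ (i : ℕ) (hi : i < n + 1),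
        (fun j : Fin T => x ⟨T * i + j, block_index_lt h hi j⟩) ∈ G} := by
      simp only [Set.ofPred_forall]
      refine MeasurableSet.iInter fun i => MeasurableSet.iInter fun hi => ?_
      exact (measurable_pi_lambda _ fun j => measurable_pi_apply _) hG
    rw [← (measurePreserving_append m T N').measure_preimage hS.nullMeasurableSet, pow_succ',
      ← ih N' h', ← Measure.prod_prod]
    congr 1
    ext z
    simp only [Set.mem_preimage, Set.mem_ofPred_eq, Set.mem_prod]
    have h0 : (fun j : Fin T => Fin.append z.1 z.2
        ⟨T * 0 + j, block_index_lt h (Nat.succ_pos n) j⟩) = z.1 := by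
      funext j
      rw [← Fin.append_left z.1 z.2 j]
      congr 1
      ext; simp
    have h1 : ∀ (i : ℕ) (hi : i < n), (fun j : Fin T => Fin.append z.1 z.2
        ⟨T * (i + 1) + j, block_index_lt h (Nat.succ_lt_succ hi) j⟩) =
        fun j : Fin T => z.2 ⟨T * i + j, block_index_lt h' hi j⟩ := by
      intro i hi
      funext j
      rw [← Fin.append_right z.1 z.2]
      congr 1
      ext
      simp only [Fin.natAdd_mk]
      ring
    constructor
    · intro hz
      refine ⟨?_, fun i hi => ?_⟩
      · have := hz 0 (Nat.succ_pos n)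
        rwa [h0] at this
      · have := hz (i + 1) (Nat.succ_lt_succ hi)
        rwa [h1 i hi] at this
    · rintro ⟨hz0, hz1⟩ i hi
      cases i with
      | zero => rw [h0]; exact hz0
      | succ i =>
        have := hz1 i (Nat.lt_of_succ_lt_succ hi)
        rwa [← h1 i (Nat.lt_of_succ_lt_succ hi)] at this

lemma walk_append_left {p q : ℕ} (g : Fin 2 → ℝ) (u : Fin p → Fin 2) (v : Fin q → Fin 2) {i : ℕ}
    (hi : i < p) : walk g (Fin.append u v) i = walk g u i := by
  simp only [walk, hi, show i < p + q by omega, dif_pos]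
  rw [← Fin.append_left u v ⟨i, hi⟩]; rfl

lemma walk_append_right {p q : ℕ} (g : Fin 2 → ℝ) (u : Fin p → Fin 2) (v : Fin q → Fin 2) {i : ℕ}
    (hi : i < q) : walk g (Fin.append u v) (p + i) = walk g v i := by
  simp only [walk, hi, show p + i < p + q by omega, dif_pos]
  rw [← Fin.append_right u v ⟨i, hi⟩]; rfl

/-- The bit sequences whose walk goes down by `ℓ` in `p` steps and up by `ℓ` in the remaining
ones. -/
def valley (a : Fin 2 → ℝ) (ℓ : ℝ) (p q : ℕ) : Set (Fin (p + q) → Fin 2) :=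
  {w | ∑ i ∈ Finset.range p, walk a w i ≤ -ℓ ∧
    ℓ ≤ ∑ i ∈ Finset.range (p + q), walk a w i - ∑ i ∈ Finset.range p, walk a w i}

lemma measure_valley (a : Fin 2 → ℝ) (ℓ : ℝ) (p q : ℕ) :
    bitMeasure (p + q) (valley a ℓ p q) =
      bitMeasure p {w | ∑ i ∈ Finset.range p, walk a w i ≤ -ℓ} *
      bitMeasure q {w | ℓ ≤ ∑ i ∈ Finset.range q, walk a w i} := by
  rw [← (measurePreserving_append fairBit p q).measure_preimage
    (Set.toFinite _).measurableSet.nullMeasurableSet, ← Measure.prod_prod]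
  congr 1
  ext z
  simp only [valley, Set.mem_preimage, Set.mem_ofPred_eq, Set.mem_prod, Finset.sum_range_add,
    add_sub_cancel_left]
  rw [Finset.sum_congr rfl fun i hi => walk_append_left a z.1 z.2 (Finset.mem_range.mp hi),
    Finset.sum_congr rfl fun i hi => walk_append_right a z.1 z.2 (Finset.mem_range.mp hi)]

/-! ### Bad blocks and the case c < c₀ -/

lemma noise_abs_lt_le (A : ℝ) {c : ℝ} (hc : 0 < c) : noise {x | |x * c + A| < c / 2} ≤ 2⁻¹ := by
  have hsub : {x : ℝ | |x * c + A| < c / 2} ⊆ Set.Ioo (-A / c - 1 / 2) (-A / c + 1 / 2) := by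
    intro x hx
    obtain ⟨h1, h2⟩ := abs_lt.mp (show |x * c + A| < c / 2 from hx)
    have e : -A / c * c = -A := div_mul_cancel₀ _ hc.ne'
    constructor
    · by_contra hn
      have := mul_le_mul_of_nonneg_right (not_lt.mp hn) hc.le
      linarith
    · by_contra hn
      have := mul_le_mul_of_nonneg_right (not_lt.mp hn) hc.le
      linarith
  calc noise {x : ℝ | |x * c + A| < c / 2} ≤
      2⁻¹ * volume (Set.Ioo (-A / c - 1 / 2) (-A / c + 1 / 2)) := by
        rw [noise_apply]
        gcongr
        exact Set.inter_subset_right.trans hsub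
    _ = 2⁻¹ := by
        rw [Real.volume_Ioo]
        norm_num

/-- A linear combination of independent uniform variables is not concentrated at a scale below
the size of one of its coefficients. -/
lemma half_le_noise_sum {T : ℕ} (c : Fin T → ℝ) (m : Fin T) (hc : 0 < c m) :
    2⁻¹ ≤ (Measure.pi fun _ : Fin T => noise) {r | c m / 2 ≤ |∑ j, r j * c j|} := by
  cases T with
  | zero => exact m.elim0
  | succ T =>
    have hS : MeasurableSet {r : Fin (T + 1) → ℝ | |∑ j, r j * c j| < c m / 2} :=
      measurableSet_lt (by fun_prop) measurable_const
    have hle : (Measure.pi fun _ : Fin (T + 1) => noise)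
        {r | |∑ j, r j * c j| < c m / 2} ≤ 2⁻¹ := by
      -- With all variables but the `m`-th frozen, the sum is x c + A, to which the one-variable
      -- bound applies whatever A is.
      have hmp := (measurePreserving_piFinSuccAbove (fun _ : Fin (T + 1) => noise) m).symm
      rw [← hmp.measure_preimage hS.nullMeasurableSet,
        Measure.prod_apply_symm (hmp.measurable hS)]
      refine (lintegral_mono fun r => (measure_mono ?_).trans
        (noise_abs_lt_le (∑ j, r j * c (m.succAbove j)) hc)).trans (by simp)
      intro x hx
      simpa [Fin.sum_univ_succAbove _ m] using hx
    have hcompl : {r : Fin (T + 1) → ℝ | c m / 2 ≤ |∑ j, r j * c j|} =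
        {r | |∑ j, r j * c j| < c m / 2}ᶜ := by
      ext; simp
    rw [hcompl, prob_compl_eq_one_sub hS, ← ENNReal.one_sub_inv_two]
    exact tsub_le_tsub_left hle 1

/-- The blocks of increments on which no trajectory stays close. -/
def badBlock (a : Fin 2 → ℝ) (M : ℝ) (T : ℕ) : Set (Fin T → Fin 2 × ℝ) :=
  {x | M * (1 + Real.exp (-∑ i ∈ Finset.range T, walk a (bits x) i)) ≤
    |∑ j : Fin T, (x j).2 * Real.exp (-∑ i ∈ Finset.range (j + 1), walk a (bits x) i)|}

lemma measurable_walk (a : Fin 2 → ℝ) (T i : ℕ) :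
    Measurable fun x : Fin T → Fin 2 × ℝ => walk a (bits x) i := by
  unfold walk bits
  split_ifs with h
  · exact (measurable_of_finite a).comp (measurable_pi_apply _).fst
  · exact measurable_const

lemma measurableSet_badBlock (a : Fin 2 → ℝ) (M : ℝ) (T : ℕ) :
    MeasurableSet (badBlock a M T) := by
  have hw := fun i => measurable_walk a T i
  refine measurableSet_le ?_ ?_
  · fun_prop
  · refine Measurable.abs (Finset.measurable_sum _ fun j _ => ?_)
    have : Measurable fun x : Fin T → Fin 2 × ℝ => (x j).2 := (measurable_pi_apply j).snd
    fun_prop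

/-- The descent makes exp(-S_p) at least 4M, and the ascent makes it at least 4M exp(-S_{p+q}); a
quarter of each bound is added. -/
lemma bad_of_valley (a : Fin 2 → ℝ) {M : ℝ} (hM : 0 < M) {p q : ℕ}
    {w : Fin (p + q) → Fin 2} (hw : w ∈ valley a (Real.log (4 * M)) p q) :
    M * (1 + Real.exp (-∑ i ∈ Finset.range (p + q), walk a w i)) ≤
      Real.exp (-∑ i ∈ Finset.range p, walk a w i) / 2 := by
  obtain ⟨h1, h2⟩ := hw
  have e1 : 4 * M ≤ Real.exp (-∑ i ∈ Finset.range p, walk a w i) := by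
    rw [← Real.log_le_iff_le_exp (by positivity)]; linarith
  have e2 : Real.exp (-∑ i ∈ Finset.range (p + q), walk a w i) * (4 * M) ≤
      Real.exp (-∑ i ∈ Finset.range p, walk a w i) := by
    rw [← Real.exp_log (show 0 < 4 * M by positivity), ← Real.exp_add, Real.exp_le_exp]
    linarith
  linarith

lemma half_measure_valley_le (a : Fin 2 → ℝ) {M : ℝ} (hM : 0 < M) {p q : ℕ} (hp : 1 ≤ p) :
    2⁻¹ * bitMeasure (p + q) (valley a (Real.log (4 * M)) p q) ≤
      incrMeasure (p + q) (badBlock a M (p + q)) := by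
  have hmp := (measurePreserving_arrowProdEquivProdArrow (Fin 2) ℝ (Fin (p + q))
    (fun _ => fairBit) (fun _ => noise)).symm
  have hB := measurableSet_badBlock a M (p + q)
  rw [incrMeasure, show (Measure.pi fun _ : Fin (p + q) => stepMeasure) =
    Measure.pi fun _ : Fin (p + q) => fairBit.prod noise from rfl,
    ← hmp.measure_preimage hB.nullMeasurableSet, Measure.prod_apply (hmp.measurable hB),
    ← lintegral_indicator_const (Set.toFinite (valley a (Real.log (4 * M)) p q)).measurableSet]
  refine lintegral_mono fun w => ?_
  by_cases hw : w ∈ valley a (Real.log (4 * M)) p q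
  · rw [Set.indicator_of_mem hw]
    -- The coefficient of the `j`-th error involves the first `j + 1` bits, so the bottom of the
    -- valley is at index `p - 1`.
    refine (half_le_noise_sum
      (fun j : Fin (p + q) => Real.exp (-∑ i ∈ Finset.range (j + 1), walk a w i))
      ⟨p - 1, by omega⟩ (Real.exp_pos _)).trans (measure_mono fun r hr => ?_)
    have h1 := bad_of_valley a hM hw
    simp only [Set.mem_ofPred_eq, Nat.sub_add_cancel hp] at hr
    exact h1.trans hr
  · rw [Set.indicator_of_notMem hw]
    exact zero_le

/-- Shadowability requires every block to be good. -/
lemma shadowProb_le_pow {l₀ l₁ d ε M : ℝ} (h₀ : 0 < l₀) (h₁ : 0 < l₁) (hd : 0 < d)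
    (hε : ε ≤ 1) (hM : ε ≤ d * M) {T n N : ℕ} (h : T * n ≤ N) :
    shadowProb l₀ l₁ d N ε ≤ incrMeasure T (badBlock (logLam l₀ l₁) M T)ᶜ ^ n := by
  have hG := (measurableSet_badBlock (logLam l₀ l₁) M T).compl
  rw [← measure_blocks stepMeasure hG n N h]
  have hS : MeasurableSet {x : Fin N → Fin 2 × ℝ | ∀ (i : ℕ) (hi : i < n),
      (fun j : Fin T => x ⟨T * i + j, block_index_lt h hi j⟩) ∈
        (badBlock (logLam l₀ l₁) M T)ᶜ} := by
    simp only [Set.ofPred_forall]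
    refine MeasurableSet.iInter fun i => MeasurableSet.iInter fun hi => ?_
    exact (measurable_pi_lambda _ fun j => measurable_pi_apply _) hG
  rw [← pathMeasure_incr l₀ l₁ hd N hS]
  refine shadowProb_le _ _ _ _ _ (measurable_incr _ _ _ _ hS) fun y hy i hi hbad => ?_
  have hk : T * i + T ≤ N := by
    have := Nat.mul_le_mul_left T (Nat.succ_le_of_lt hi)
    rw [Nat.mul_succ] at this
    omega
  have h1 := block_of_shadowable h₀ h₁ hd hε hy
    (fun j : Fin T => incr l₀ l₁ d y ⟨T * i + j, block_index_lt h hi j⟩) (T * i) hk fun _ => rfl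
  have h2 := mul_le_mul_of_nonneg_left hbad hd.le
  rw [← mul_assoc] at h2
  set E := Real.exp (-∑ i_1 ∈ Finset.range T, walk (logLam l₀ l₁)
    (bits fun j : Fin T => incr l₀ l₁ d y ⟨T * i + j, block_index_lt h hi j⟩) i_1) with hE
  have hE0 : 0 < E := Real.exp_pos _
  have h3 : ε * (1 + E) ≤ d * M * (1 + E) := mul_le_mul_of_nonneg_right hM (by linarith)
  linarith

/-- A good block of length 1 confines its only error to |r| < M (1 + λ). For c < 0, where M = N^c
tends to 0, this one step already prevents shadowing. -/
lemma measure_compl_badBlock_one_le {l₀ l₁ M : ℝ} (h₀ : 0 < l₀) (h₀₁ : l₀ ≤ l₁) (hM : 0 ≤ M) :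
    incrMeasure 1 (badBlock (logLam l₀ l₁) M 1)ᶜ ≤ ENNReal.ofReal (M * (1 + l₁)) := by
  have h₁ := h₀.trans_le h₀₁
  have hmp : MeasurePreserving (fun x : Fin 1 → Fin 2 × ℝ => (x 0).2) (incrMeasure 1) noise :=
    (measurePreserving_snd (μ := fairBit) (ν := noise)).comp
      (measurePreserving_eval (fun _ : Fin 1 => stepMeasure) 0)
  calc _ ≤ incrMeasure 1 ((fun x : Fin 1 → Fin 2 × ℝ => (x 0).2) ⁻¹'
        Set.Ioo (-(M * (1 + l₁))) (M * (1 + l₁))) := by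
        refine measure_mono fun x hx => ?_
        rw [badBlock, Set.mem_compl_iff, Set.mem_ofPred_eq, not_le] at hx
        simp only [Finset.univ_unique, Fin.default_eq_zero, Finset.sum_singleton, Fin.val_zero,
          zero_add, Finset.range_one, abs_mul, Real.abs_exp] at hx
        have hw : Real.exp (-walk (logLam l₀ l₁) (bits x) 0) * lam l₀ l₁ (x 0).1 = 1 := by
          rw [← exp_logLam h₀ h₁, ← Real.exp_add]
          simp [walk, bits]
        have hl : lam l₀ l₁ (x 0).1 ≤ l₁ := by unfold lam; split_ifs <;> simp [h₀₁]
        have hl0 := lam_pos h₀ h₁ (x 0).1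
        have h1 := mul_lt_mul_of_pos_right hx hl0
        rw [mul_assoc, hw, mul_one, mul_assoc, add_mul, hw, one_mul] at h1
        have h2 : M * (lam l₀ l₁ (x 0).1 + 1) ≤ M * (1 + l₁) :=
          mul_le_mul_of_nonneg_left (by linarith) hM
        exact abs_lt.mp (h1.trans_le h2)
    _ = noise (Set.Ioo (-(M * (1 + l₁))) (M * (1 + l₁))) :=
        hmp.measure_preimage measurableSet_Ioo.nullMeasurableSet
    _ ≤ 2⁻¹ * volume (Set.Ioo (-(M * (1 + l₁))) (M * (1 + l₁))) := by
        rw [noise_apply]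
        gcongr
        exact Set.inter_subset_right
    _ = ENNReal.ofReal (M * (1 + l₁)) := by
        rw [Real.volume_Ioo, show M * (1 + l₁) - -(M * (1 + l₁)) = 2 * (M * (1 + l₁)) by ring,
          ENNReal.ofReal_mul (by norm_num), ← mul_assoc]
        norm_num
        rw [ENNReal.inv_mul_cancel (by simp) (by simp), one_mul]

lemma tendsto_shadowProb_of_neg {l₀ l₁ ε c : ℝ} (h₀ : 0 < l₀) (h₀₁ : l₀ ≤ l₁) (hε0 : 0 < ε)
    (hε : ε ≤ 1) (hc : c < 0) :
    Filter.Tendsto (fun N : ℕ => shadowProb l₀ l₁ (ε / (N : ℝ) ^ c) N ε) Filter.atTop (nhds 0) := by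
  have ht : Filter.Tendsto (fun N : ℕ => ENNReal.ofReal ((N : ℝ) ^ c * (1 + l₁)))
      Filter.atTop (nhds 0) := by
    have h1 : Filter.Tendsto (fun N : ℕ => (N : ℝ) ^ c) Filter.atTop (nhds 0) := by
      have := (tendsto_rpow_neg_atTop (neg_pos.mpr hc)).comp
        (tendsto_natCast_atTop_atTop (R := ℝ))
      simpa [Function.comp_def] using this
    have h2 := ENNReal.tendsto_ofReal (h1.mul_const (1 + l₁))
    simpa using h2
  refine tendsto_of_tendsto_of_tendsto_of_le_of_le' tendsto_const_nhds ht
    (.of_forall fun _ => zero_le) ?_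
  filter_upwards [Filter.eventually_ge_atTop 1] with N hN
  have hN0 : (0 : ℝ) < (N : ℝ) ^ c := Real.rpow_pos_of_pos (by exact_mod_cast hN) _
  have h1 := shadowProb_le_pow (M := (N : ℝ) ^ c) h₀ (h₀.trans_le h₀₁) (div_pos hε0 hN0) hε
    (div_mul_cancel₀ _ hN0.ne').ge (T := 1) (n := 1) (N := N) (by omega)
  rw [pow_one] at h1
  exact h1.trans (measure_compl_badBlock_one_le h₀ h₀₁ hN0.le)

lemma tendsto_exponent {c β C K : ℝ} (hc : 0 < c) (hβ : 0 < β) (hcβ : c * β < 1) (hC : 0 < C)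
    (hK : 0 < K) : Filter.Tendsto (fun N : ℕ => C * Real.exp (-(β * Real.log (4 * (N : ℝ) ^ c))) *
      (N / (K * Real.log (4 * (N : ℝ) ^ c)) - 1)) Filter.atTop Filter.atTop := by
  set s := 1 - c * β with hs
  have hs0 : 0 < s := by rw [hs]; linarith
  -- Chosen so that log Y ≤ Y^e / e costs a factor N^(s/2), half of the surplus exponent s = 1 - cβ.
  set e := s / (2 * c) with he
  have he0 : 0 < e := by positivity
  set D := C * 4 ^ (-β) * e / (K * 4 ^ e) with hD
  have hD0 : 0 < D := by positivity
  have ht : Filter.Tendsto (fun N : ℕ => D * (N : ℝ) ^ (s / 2) - C) Filter.atTop Filter.atTop := by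
    refine Filter.tendsto_atTop_add_const_right _ _ (Filter.Tendsto.const_mul_atTop hD0 ?_)
    exact (tendsto_rpow_atTop (by positivity)).comp tendsto_natCast_atTop_atTop
  refine Filter.tendsto_atTop_mono' _ ?_ ht
  filter_upwards [Filter.eventually_ge_atTop 1] with N hN
  have hN1 : (1 : ℝ) ≤ N := by exact_mod_cast hN
  have hN0 : (0 : ℝ) < N := by linarith
  have hM1 : 1 ≤ (N : ℝ) ^ c := Real.one_le_rpow hN1 hc.le
  set Y := 4 * (N : ℝ) ^ c with hY
  have hY1 : 1 < Y := by rw [hY]; linarith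
  have hY0 : 0 < Y := by linarith
  have hℓ0 : 0 < Real.log Y := Real.log_pos hY1
  have hℓ : Real.log Y ≤ Y ^ e / e := Real.log_le_rpow_div hY0.le he0
  have hYe : Y ^ e = 4 ^ e * (N : ℝ) ^ (s / 2) := by
    rw [hY, Real.mul_rpow (by norm_num) (by positivity), ← Real.rpow_mul hN0.le]
    congr 2
    rw [he]; field_simp
  have hexp : Real.exp (-(β * Real.log Y)) = 4 ^ (-β) * (N : ℝ) ^ (-(c * β)) := by
    rw [← neg_mul, mul_comm, ← Real.rpow_def_of_pos hY0, hY,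
      Real.mul_rpow (by norm_num) (by positivity), ← Real.rpow_mul hN0.le]
    congr 2; ring
  have hexp1 : Real.exp (-(β * Real.log Y)) ≤ 1 := by
    rw [Real.exp_le_one_iff]; nlinarith
  have h1 : N / (K * (Y ^ e / e)) ≤ N / (K * Real.log Y) := by
    gcongr
  have h2 : C * Real.exp (-(β * Real.log Y)) * (N / (K * (Y ^ e / e))) = D * (N : ℝ) ^ (s / 2) := by
    have e1 : (N : ℝ) ^ (s / 2) * (N : ℝ) ^ (s / 2) = (N : ℝ) ^ (-(c * β)) * N := by
      nth_rewrite 4 [← Real.rpow_one (N : ℝ)]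
      rw [← Real.rpow_add hN0, ← Real.rpow_add hN0, hs]
      congr 1; ring
    rw [hexp, hYe, hD]
    have : (N : ℝ) ^ (s / 2) ≠ 0 := by positivity
    generalize (N : ℝ) ^ (-(c * β)) = z at e1 ⊢
    field_simp
    linear_combination -e1
  have hCe : 0 ≤ C * Real.exp (-(β * Real.log Y)) := by positivity
  have h3 := mul_le_mul_of_nonneg_left h1 hCe
  have h4 : C * Real.exp (-(β * Real.log Y)) ≤ C := mul_le_of_le_one_right hC.le hexp1
  rw [mul_sub, mul_one]
  linarith

lemma tendsto_shadowProb_zero {l₀ l₁ ε b c c' : ℝ} (h₀ : 0 < l₀) (h₀' : l₀ < 1) (h₁ : 1 < l₁)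
    (hb0 : b ≠ 0) (hb : IsRuinRoot l₀ l₁ b) (hε0 : 0 < ε) (hε : ε ≤ 1) (hcc : c ≤ c')
    (hc' : 0 < c') (hcb : c' < 1 / |b|) :
    Filter.Tendsto (fun N : ℕ => shadowProb l₀ l₁ (ε / (N : ℝ) ^ c) N ε) Filter.atTop (nhds 0) := by
  have hbpos : 0 < |b| := abs_pos.mpr hb0
  set a := logLam l₀ l₁ with ha
  have ha0 : a 0 < 0 := Real.log_neg (by simpa [lam]) (by simpa [lam])
  obtain ⟨β, hβ1, hβ2⟩ := exists_between
    (show |b| < 1 / c' by rw [lt_div_iff₀ hbpos] at hcb; rw [lt_div_iff₀ hc']; linarith)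
  rw [lt_div_iff₀ hc'] at hβ2
  obtain ⟨C, K, hC, hK, hval⟩ := exists_valley a ha0 hb0 ((isRuinRoot_iff _ _ _).mp hb) hβ1
  have hβ0 : 0 < β := hbpos.trans hβ1
  have ht := tendsto_exponent hc' hβ0 (by linarith) (half_pos hC) hK
  have ht' := ENNReal.tendsto_ofReal (Real.tendsto_exp_neg_atTop_nhds_zero.comp ht)
  rw [ENNReal.ofReal_zero] at ht'
  refine tendsto_of_tendsto_of_tendsto_of_le_of_le' tendsto_const_nhds ht'
    (.of_forall fun _ => zero_le) ?_
  filter_upwards [Filter.eventually_ge_atTop 1] with N hN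
  have hN1 : (1 : ℝ) ≤ N := by exact_mod_cast hN
  have hN0 : (0 : ℝ) < N := by linarith
  set M := (N : ℝ) ^ c' with hMdef
  have hM1 : 1 ≤ M := Real.one_le_rpow hN1 hc'.le
  have hM0 : 0 < M := by linarith
  have hNc : (0 : ℝ) < (N : ℝ) ^ c := Real.rpow_pos_of_pos hN0 _
  set ℓ := Real.log (4 * M) with hℓdef
  have hℓ : 1 ≤ ℓ := by
    rw [hℓdef, Real.le_log_iff_exp_le (by positivity)]
    linarith [Real.exp_one_lt_d9]
  obtain ⟨p, q, hp, hpq, hpr⟩ := hval ℓ hℓ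
  set T := p + q with hT
  have hT0 : 0 < T := by omega
  have hM : ε ≤ ε / (N : ℝ) ^ c * M := by
    rw [div_mul_eq_mul_div, le_div_iff₀ hNc]
    exact mul_le_mul_of_nonneg_left (Real.rpow_le_rpow_of_exponent_le hN1 hcc) hε0.le
  have h1 := shadowProb_le_pow h₀ (h₀.trans (h₀'.trans h₁)) (div_pos hε0 hNc) hε hM
    (Nat.mul_div_le N T)
  refine h1.trans ?_
  set x := C / 2 * Real.exp (-(β * ℓ)) with hx
  have hx0 : 0 < x := by positivity
  have hbad : ENNReal.ofReal x ≤ incrMeasure T (badBlock a M T) := by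
    refine le_trans ?_ (half_measure_valley_le a hM0 hp)
    rw [measure_valley, ← ENNReal.ofReal_toReal (a := 2⁻¹ * _) (by finiteness)]
    refine ENNReal.ofReal_le_ofReal ?_
    rw [ENNReal.toReal_mul, ENNReal.toReal_mul]
    change x ≤ _ * ((bitMeasure p).real _ * (bitMeasure q).real _)
    rw [hx, ENNReal.toReal_inv, ENNReal.toReal_ofNat]
    linarith
  have hcompl : incrMeasure T (badBlock a M T)ᶜ ≤ ENNReal.ofReal (Real.exp (-x)) := by
    rw [prob_compl_eq_one_sub (measurableSet_badBlock _ _ _)]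
    calc _ ≤ 1 - ENNReal.ofReal x := tsub_le_tsub_left hbad 1
      _ = ENNReal.ofReal (1 - x) := by
        rw [ENNReal.ofReal_sub _ hx0.le, ENNReal.ofReal_one]
      _ ≤ _ := ENNReal.ofReal_le_ofReal (Real.one_sub_le_exp_neg x)
  refine (pow_le_pow_left' hcompl _).trans ?_
  rw [← ENNReal.ofReal_pow (Real.exp_pos _).le, ← Real.exp_nat_mul]
  refine ENNReal.ofReal_le_ofReal (Real.exp_le_exp.mpr ?_)
  have hT1 : (T : ℝ) ≤ K * ℓ := by rw [hT]; push_cast; exact hpq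
  have hT0' : (0 : ℝ) < T := by exact_mod_cast hT0
  have hdiv : (N : ℝ) / (K * ℓ) - 1 ≤ ((N / T : ℕ) : ℝ) := by
    have h2 : (N : ℝ) / (K * ℓ) ≤ N / T := by gcongr
    have h3 : (N : ℝ) < T * ((N / T : ℕ) + 1) := by
      exact_mod_cast Nat.lt_mul_div_succ N hT0
    have h4 : (N : ℝ) / T < (N / T : ℕ) + 1 := by
      rw [div_lt_iff₀ hT0']; linarith
    linarith
  rw [mul_neg, mul_comm _ x]
  exact neg_le_neg (mul_le_mul_of_nonneg_left hdiv hx0.le)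

/-! ### The case c > c₀ -/

/-- A sufficient condition on the bits bounds the probability of shadowing from below. -/
lemma bitMeasure_le_shadowProb {l₀ l₁ d ε : ℝ} (hd : 0 < d) {N : ℕ} (W : Set (Fin N → Fin 2))
    (h : ∀ y ∈ admissible l₀ l₁ d N, bits (incr l₀ l₁ d y) ∈ W → Shadowable l₀ l₁ ε y) :
    bitMeasure N W ≤ shadowProb l₀ l₁ d N ε := by
  have := isProbabilityMeasure_pathMeasure l₀ l₁ hd N
  have hW : MeasurableSet W := (Set.toFinite W).measurableSet
  have hW' := (measurePreserving_bits N).measurable hW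
  rw [← (measurePreserving_bits N).measure_preimage hW.nullMeasurableSet,
    ← pathMeasure_incr l₀ l₁ hd N hW']
  have hadm := measurableSet_admissible l₀ l₁ d N
  have h1 : pathMeasure l₀ l₁ d N (admissible l₀ l₁ d N)ᶜ = 0 := by
    rw [prob_compl_eq_zero_iff hadm, pathMeasure_admissible _ _ hd]
  rw [← measure_inter_conull h1]
  exact le_shadowProb _ _ _ _ _ ((measurable_incr _ _ _ _ hW').inter hadm)
    fun y hy => h y hy.2 hy.1

lemma tendsto_shadowProb_one_of_bad {l₀ l₁ ε c p C : ℝ} (hε0 : 0 < ε) (hcp : 1 < c * p)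
    (B : (N : ℕ) → ℕ → Set (Fin N → Fin 2))
    (hB : ∀ N : ℕ, 1 ≤ N → ∀ n ≤ N, (bitMeasure N).real (B N n) ≤ C * ((N : ℝ) ^ c) ^ (-p))
    (h : ∀ N : ℕ, 1 ≤ N → ∀ y ∈ admissible l₀ l₁ (ε / (N : ℝ) ^ c) N,
      (∀ n ≤ N, bits (incr l₀ l₁ (ε / (N : ℝ) ^ c) y) ∉ B N n) → Shadowable l₀ l₁ ε y) :
    Filter.Tendsto (fun N : ℕ => shadowProb l₀ l₁ (ε / (N : ℝ) ^ c) N ε) Filter.atTop (nhds 1) := by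
  have ht : Filter.Tendsto (fun N : ℕ => 1 - 2 * C * (N : ℝ) ^ (-(c * p - 1)))
      Filter.atTop (nhds 1) := by
    have h1 := (tendsto_rpow_neg_atTop (sub_pos.mpr hcp)).comp (tendsto_natCast_atTop_atTop (R := ℝ))
    have h2 := (h1.const_mul (2 * C)).const_sub 1
    simpa [Function.comp_def] using h2
  have ht' := ENNReal.tendsto_ofReal ht
  rw [ENNReal.ofReal_one] at ht'
  refine tendsto_of_tendsto_of_tendsto_of_le_of_le' ht' tendsto_const_nhds ?_ ?_
  · filter_upwards [Filter.eventually_ge_atTop 1] with N hN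
    have hN1 : (1 : ℝ) ≤ N := by exact_mod_cast hN
    have hN0 : (0 : ℝ) < N := by linarith
    have hNc : (0 : ℝ) < (N : ℝ) ^ c := Real.rpow_pos_of_pos hN0 _
    set U : Set (Fin N → Fin 2) := ⋃ n ∈ Finset.range (N + 1), B N n with hU
    have hle := bitMeasure_le_shadowProb (ε := ε) (div_pos hε0 hNc) Uᶜ fun y hy hyU =>
      h N hN y hy fun n hn hyB => hyU (Set.mem_biUnion (by simpa using Nat.lt_succ_of_le hn) hyB)
    refine le_trans ?_ hle
    rw [← ofReal_measureReal, probReal_compl_eq_one_sub (Set.toFinite U).measurableSet]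
    refine ENNReal.ofReal_le_ofReal (sub_le_sub_left ?_ 1)
    have hC : 0 ≤ C * ((N : ℝ) ^ c) ^ (-p) := measureReal_nonneg.trans (hB N hN 0 (by omega))
    calc (bitMeasure N).real U ≤ ∑ n ∈ Finset.range (N + 1), (bitMeasure N).real (B N n) :=
          measureReal_biUnion_finset_le _ _
      _ ≤ ∑ n ∈ Finset.range (N + 1), C * ((N : ℝ) ^ c) ^ (-p) :=
          Finset.sum_le_sum fun n hn => hB N hN n (by simpa [Nat.lt_succ_iff] using hn)
      _ = (N + 1) * (C * ((N : ℝ) ^ c) ^ (-p)) := by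
          rw [Finset.sum_const, Finset.card_range, nsmul_eq_mul]; push_cast; rfl
      _ ≤ (2 * N) * (C * ((N : ℝ) ^ c) ^ (-p)) :=
          mul_le_mul_of_nonneg_right (by linarith) hC
      _ = 2 * C * (N : ℝ) ^ (-(c * p - 1)) := by
          have : (N : ℝ) ^ (-(c * p - 1)) = N * ((N : ℝ) ^ c) ^ (-p) := by
            rw [← Real.rpow_mul hN0.le, show -(c * p - 1) = 1 + c * -p by ring,
              Real.rpow_add hN0, Real.rpow_one]
          rw [this]; ring
  · filter_upwards [Filter.eventually_ge_atTop 1] with N hN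
    have hN0 : (0 : ℝ) < N := by exact_mod_cast hN
    exact shadowProb_le_one _ _ (div_pos hε0 (Real.rpow_pos_of_pos hN0 _)) _ _

lemma tendsto_shadowProb_one {l₀ l₁ ε b c : ℝ} (h₀ : 0 < l₀) (h₀' : l₀ < 1) (h₁ : 1 < l₁)
    (hb0 : b ≠ 0) (hb : IsRuinRoot l₀ l₁ b) (hε0 : 0 < ε) (hcb : 1 / |b| < c) :
    Filter.Tendsto (fun N : ℕ => shadowProb l₀ l₁ (ε / (N : ℝ) ^ c) N ε) Filter.atTop (nhds 1) := by
  have hbpos : 0 < |b| := abs_pos.mpr hb0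
  have hc : 0 < c := lt_trans (by positivity) hcb
  have hl₁ : 0 < l₁ := h₀.trans (h₀'.trans h₁)
  set a := logLam l₀ l₁ with ha
  have ha0 : a 0 < 0 := Real.log_neg (by simpa [lam]) (by simpa [lam])
  obtain ⟨p, hp1, hp2⟩ := exists_between
    (show 1 / c < |b| by rw [div_lt_iff₀ hbpos] at hcb; rw [div_lt_iff₀ hc]; linarith)
  have hp0 : 0 < p := lt_trans (by positivity) hp1
  have hcp : 1 < c * p := by rw [div_lt_iff₀ hc] at hp1; linarith
  have hlt := expMean_smul_lt_one (mul_ne_zero (neg_ne_zero.mpr hb0) ha0.ne)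
    ((isRuinRoot_iff _ _ _).mp hb) (s := p / |b|) (by positivity) ((div_lt_one hbpos).mpr hp2)
  have hM : ∀ N : ℕ, 1 ≤ N → 0 < (N : ℝ) ^ c := fun N hN =>
    Real.rpow_pos_of_pos (by exact_mod_cast hN) _
  have hdε : ∀ N : ℕ, 1 ≤ N → ε / (N : ℝ) ^ c ≤ ε := fun N hN =>
    div_le_self hε0.le (Real.one_le_rpow (by exact_mod_cast hN) hc.le)
  have hscale : ∀ (N : ℕ), 1 ≤ N → ∀ x : ℝ, x < (N : ℝ) ^ c → ε / (N : ℝ) ^ c * x < ε := by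
    intro N hN x hx
    rw [div_mul_eq_mul_div, div_lt_iff₀ (hM N hN)]
    exact mul_lt_mul_of_pos_left hx hε0
  -- The sign of b is that of the drift. A contracting drift damps errors forward in time, so the
  -- zero trajectory is used; an expanding one damps them backward, so the end point is matched.
  rcases hb0.lt_or_gt with hneg | hpos
  · have hg : expMean (fun v => p * a v) < 1 := by
      convert hlt using 3 with v
      rw [abs_of_neg hneg, ha]; field_simp
    obtain ⟨C, -, hC⟩ := measure_sum_exp_ge_le a hp0 hg
    refine tendsto_shadowProb_one_of_bad hε0 hcp (C := C)
      (fun N n => {w | (N : ℝ) ^ c ≤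
        ∑ j ∈ Finset.range n, Real.exp (∑ i ∈ Finset.Ico (j + 1) n, walk a w i)})
      (fun N hN n hn => ?_) fun N hN y hy hgood => ?_
    · refine hC N (Finset.range n) (fun j => Finset.Ico (j + 1) n) (fun j => n - (j + 1))
        ?_ ?_ ?_ _ (hM N hN)
      · intro i hi j hj hij
        simp only [Finset.coe_range, Set.mem_Iio] at hi hj
        simp only at hij
        omega
      · intro j _ i hi
        simp only [Finset.mem_Ico, Finset.mem_range] at hi ⊢
        omega
      · intro j _; simp
    · exact shadowable_of_forward h₀ hl₁ (div_pos hε0 (hM N hN)) (hdε N hN) hy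
        fun n hn => hscale N hN _ (not_le.mp (hgood n hn))
  · have hg : expMean (fun v => p * -a v) < 1 := by
      convert hlt using 3 with v
      rw [abs_of_pos hpos, ha]; field_simp
    obtain ⟨C, -, hC⟩ := measure_sum_exp_ge_le (fun v => -a v) hp0 hg
    refine tendsto_shadowProb_one_of_bad hε0 hcp (C := C)
      (fun N k => {w | (N : ℝ) ^ c ≤ ∑ j ∈ Finset.range (N - k),
        Real.exp (∑ i ∈ Finset.Ico k (k + j + 1), walk (fun v => -a v) w i)})
      (fun N hN k hk => ?_) fun N hN y hy hgood => ?_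
    · refine hC N (Finset.range (N - k)) (fun j => Finset.Ico k (k + j + 1)) (fun j => j)
        (fun _ _ _ _ h => h) ?_ ?_ _ (hM N hN)
      · intro j hj i hi
        simp only [Finset.mem_Ico, Finset.mem_range] at hi hj ⊢
        omega
      · intro j _; rw [Nat.card_Ico]; omega
    · exact shadowable_of_backward h₀ hl₁ (div_pos hε0 (hM N hN)) (hdε N hN) hy
        fun k hk => hscale N hN _ (not_le.mp (hgood k hk))

end LinearSkewProduct


/-! ### The theorem -/

theorem theorem1 (l₀ l₁ : ℝ) (h₀ : 0 < l₀) (h₀' : l₀ < 1) (h₁ : 1 < l₁) (h₀₁ : l₀ * l₁ ≠ 1) :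
    ∃ ε₀ : ℝ, 0 < ε₀ ∧ ∃ c₀ : ℝ, 0 < c₀ ∧
      (∃ b : ℝ, b ≠ 0 ∧ LinearSkewProduct.IsRuinRoot l₀ l₁ b ∧
        (∀ b' : ℝ, b' ≠ 0 → LinearSkewProduct.IsRuinRoot l₀ l₁ b' → b' = b) ∧
        (0 < b ↔ 1 < l₀ * l₁) ∧ c₀ = 1 / |b|) ∧
      ∀ ε : ℝ, 0 < ε → ε < ε₀ →
        (∀ c : ℝ, c < c₀ → Filter.Tendsto
          (fun N : ℕ => LinearSkewProduct.shadowProb l₀ l₁ (ε / (N : ℝ) ^ c) N ε)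
          Filter.atTop (nhds 0)) ∧
        (∀ c : ℝ, c₀ < c → Filter.Tendsto
          (fun N : ℕ => LinearSkewProduct.shadowProb l₀ l₁ (ε / (N : ℝ) ^ c) N ε)
          Filter.atTop (nhds 1)) := by
  have hl₁ : 0 < l₁ := h₀.trans (h₀'.trans h₁)
  have hsum : LinearSkewProduct.logLam l₀ l₁ 0 + LinearSkewProduct.logLam l₀ l₁ 1 =
      Real.log (l₀ * l₁) := by
    rw [Real.log_mul h₀.ne' hl₁.ne']; rfl
  have hpos : 0 < l₀ * l₁ := mul_pos h₀ hl₁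
  obtain ⟨b, hb0, hb, huniq, hsign⟩ := LinearSkewProduct.exists_unique_root
    (LinearSkewProduct.logLam l₀ l₁) (Real.log_neg h₀ h₀') (Real.log_pos h₁) (by
      rw [hsum]
      exact Real.log_ne_zero_of_pos_of_ne_one hpos h₀₁)
  have hbpos : 0 < 1 / |b| := one_div_pos.mpr (abs_pos.mpr hb0)
  rw [hsum] at hsign
  -- The threshold 1 is the scale below which points at distance less than ε share the bit at 0.
  refine ⟨1, one_pos, 1 / |b|, hbpos, ⟨b, hb0, hb, huniq, ?_, rfl⟩, fun ε hε0 hε =>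
    ⟨fun c hc => ?_, fun c hc => ?_⟩⟩
  · rw [← Real.log_pos_iff hpos.le]
    exact ⟨fun h => pos_of_mul_pos_right hsign h.le, fun h => pos_of_mul_pos_left hsign h.le⟩
  · rcases lt_or_ge c 0 with hc0 | hc0
    · exact LinearSkewProduct.tendsto_shadowProb_of_neg h₀ (h₀'.trans h₁).le hε0 hε.le hc0
    · obtain ⟨c', hc1, hc2⟩ := exists_between hc
      exact LinearSkewProduct.tendsto_shadowProb_zero h₀ h₀' h₁ hb0 hb hε0 hε.le hc1.le
        (hc0.trans_lt hc1) hc2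
  · exact LinearSkewProduct.tendsto_shadowProb_one h₀ h₀' h₁ hb0 hb hε0 hc
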